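/- Let $X=(F,G,H)$ be a holomorphic vector field on an open neighbourhood $U$ of $0\in\mathbb C^3$ with $X(0)=0$, and consider the system $\dot x=F$, $\dot y=G$, $\dot z=H$ in real time. Let $\Lambda=DX(0)$. Assume that $\Lambda$ is diagonalizable, with a double purely imaginary eigenvalue $i\omega_1$ whose eigenspace is the $(x,y)$-plane, and another purely imaginary eigenvalue $i\omega_2$ whose eigenspace is the $z$-axis, where $\omega_1,\omega_2\in\mathbb R\setminus\{0\}$, $\omega_1\ne\omega_2$ and $|\omega_1|\le|\omega_2|$. Here a holomorphic center manifold at the origin is a one-dimensional complex submanifold $M\subset U$ (an embedded holomorphic disc) through $0$ which is locally invariant under the flow. It is called $x$-, $y$-, $z$- or $(x,y)$-invariant if its tangent line at $0$ is contained in the $x$-axis, the $y$-axis, the $z$-axis or the $(x,y)$-plane, respectively. It contains an isochronous center family of period $T$ if every point of $M\setminus\{0\}$ close enough to $0$ lies on a periodic orbit contained in $M$ with least period $T$. Center manifolds are counted by their germs at $0$. For $\omega_2/\omega_1=n\in\mathbb N$ (so $n\ge2$) define numbers $\bar r,\hat r$ as follows. Curves $(yu(y),y,yv(y))$ invariant under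 $X$ satisfy $$yu'=\frac{F/y}{G/y}-u,\qquad yv'=\frac{H/y}{G/y}-v\qquad(F,G,H\text{ evaluated at }(yu,y,yv)),$$ a system of the form $yu'=py+qu+O(2)$, $yv'=ry+sv+O(2)$ with $q=0$ and $s=n-1$. Apply $n-2$ times the change of unknowns $u=y\bigl(\tilde u+\frac p{1-q}\bigr)$, $v=y\bigl(\tilde v+\frac r{1-s}\bigr)$, which again gives a system of this form, with new coefficients $\tilde p,\ \tilde q=q-1,\ \tilde r,\ \tilde s=s-1$. Then $\bar r$ is the coefficient of $y$ in the second equation of the resulting system. The number $\hat r$ is defined in the same way from curves $(x,xu(x),xv(x))$, that is, from the system $xu'=\frac{G/x}{F/x}-u$, $xv'=\frac{H/x}{F/x}-v$, with $F,G,H$ evaluated at $(x,xu,xv)$. Then: 1) There is a $z$-invariant holomorphic center manifold at the origin which contains an isochronous center family of period $2\pi/|\omega_2|$. 2.1) If $\omega_2/\omega_1\notin\mathbb N$, or if $\omega_2/\omega_1\in\mathbb N$ and $\bar r=0=\hat r$, then there are infinitely many $(x,y)$-invariant holomorphic center manifolds at the origin, each of which contains an isochronous center family of period $2\pi/|\omega_1|$.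 2.2) If $\omega_2/\omega_1\in\mathbb N$ and $\bar r=0\ne\hat r$, then there are infinitely many $y$-invariant holomorphic center manifolds at the origin, each of which contains an isochronous center family of period $2\pi/|\omega_1|$. 2.3) If $\omega_2/\omega_1\in\mathbb N$ and $\bar r\ne0=\hat r$, then there are infinitely many $x$-invariant holomorphic center manifolds at the origin, each of which contains an isochronous center family of period $2\pi/|\omega_1|$. -/

import Mathlib

open Complex Metric Topology

noncomputable section

namespace CenterFamily

/-- The phase space `ℂ³`, with coordinates `x = w 0`, `y = w 1`, `z = w 2`. -/
abbrev Phase : Type := Fin 3 → ℂ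

/-- The `x`-axis. -/
def xAxis : Submodule ℂ Phase := Submodule.span ℂ {![1, 0, 0]}

/-- The `y`-axis. -/
def yAxis : Submodule ℂ Phase := Submodule.span ℂ {![0, 1, 0]}

/-- The `z`-axis. -/
def zAxis : Submodule ℂ Phase := Submodule.span ℂ {![0, 0, 1]}

/-- The `(x, y)`-plane. -/
def xyPlane : Submodule ℂ Phase := Submodule.span ℂ {![1, 0, 0], ![0, 1, 0]}

/-- `M` is locally invariant under the flow of `ẇ = X w` in real time: through every point of `M`
there is a solution which stays in `M` for a short time, forwards and backwards. -/
def LocallyInvariant (X : Phase → Phase) (M : Set Phase) : Prop :=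
  ∀ p ∈ M, ∃ ε : ℝ, 0 < ε ∧ ∃ γ : ℝ → Phase, γ 0 = p ∧
    ∀ t ∈ Set.Ioo (-ε) ε, γ t ∈ M ∧ HasDerivAt γ (X (γ t)) t

/-- `M` is a holomorphic center manifold at the origin of the system `ẇ = X w` on the domain `U`,
tangent to `L` (for short: an `L`-invariant one): an embedded holomorphic disc in `U`
through the origin, locally invariant under the flow, whose tangent line at the origin is
contained in `L`. -/
def IsCenterManifold (U : Set Phase) (X : Phase → Phase) (L : Submodule ℂ Phase)
    (M : Set Phase) : Prop :=
  M ⊆ U ∧ LocallyInvariant X M ∧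
    ∃ ρ : ℝ, 0 < ρ ∧ ∃ φ : ℂ → Phase,
      DifferentiableOn ℂ φ (ball 0 ρ) ∧
      IsEmbedding (fun s : ball (0 : ℂ) ρ => φ s) ∧
      (∀ s ∈ ball (0 : ℂ) ρ, deriv φ s ≠ 0) ∧
      φ '' ball 0 ρ = M ∧ φ 0 = 0 ∧ deriv φ 0 ∈ L

/-- `M` contains an isochronous center family of period `T` around the origin: through every
point of `M` other than the origin and close enough to it passes a solution which is defined for
all real times, stays in `M`, and is periodic with least period `T`. -/
def HasIsochronousFamily (X : Phase → Phase) (M : Set Phase) (T : ℝ) : Prop :=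
  ∃ N ∈ 𝓝 (0 : Phase), ∀ p ∈ M ∩ N, p ≠ 0 →
    ∃ γ : ℝ → Phase, γ 0 = p ∧ (∀ t, γ t ∈ M ∧ HasDerivAt γ (X (γ t)) t) ∧
      0 < T ∧ Function.Periodic γ T ∧
      ∀ T' : ℝ, 0 < T' → T' < T → ¬ Function.Periodic γ T'

/-- There is a holomorphic center manifold at the origin tangent to `L` which contains an
isochronous center family of period `T`. -/
def ExistsCenterFamily (U : Set Phase) (X : Phase → Phase) (L : Submodule ℂ Phase)
    (T : ℝ) : Prop :=
  ∃ M : Set Phase, IsCenterManifold U X L M ∧ HasIsochronousFamily X M T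

/-- There are infinitely many holomorphic center manifolds at the origin tangent to `L`, each of
which contains an isochronous center family of period `T`. Center manifolds are told apart by
their germs at the origin, so that shrinking one of them does not give a new one. -/
def InfinitelyManyCenterFamilies (U : Set Phase) (X : Phase → Phase) (L : Submodule ℂ Phase)
    (T : ℝ) : Prop :=
  ∃ M : ℕ → Set Phase,
    (∀ k, IsCenterManifold U X L (M k) ∧ HasIsochronousFamily X (M k) T) ∧
    ∀ j k, j ≠ k → ¬ ∀ᶠ p in 𝓝 (0 : Phase), (p ∈ M j ↔ p ∈ M k)

/-- The right-hand sides of a system `τ u' = P(τ, u, v)`, `τ v' = Q(τ, u, v)`. -/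
structure BriotBouquet where
  P : ℂ → ℂ → ℂ → ℂ
  Q : ℂ → ℂ → ℂ → ℂ

namespace BriotBouquet

/-- The coefficient `p` in `τ u' = p τ + q u + ⋯`. -/
def p (S : BriotBouquet) : ℂ := deriv (fun τ => S.P τ 0 0) 0

/-- The coefficient `q` in `τ u' = p τ + q u + ⋯`. -/
def q (S : BriotBouquet) : ℂ := deriv (fun u => S.P 0 u 0) 0

/-- The coefficient `r` in `τ v' = r τ + s v + ⋯`. -/
def r (S : BriotBouquet) : ℂ := deriv (fun τ => S.Q τ 0 0) 0

/-- The coefficient `s` in `τ v' = r τ + s v + ⋯`. -/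
def s (S : BriotBouquet) : ℂ := deriv (fun v => S.Q 0 0 v) 0

/-- The system in the new unknowns `ũ`, `ṽ` given by `u = τ (ũ + p / (1 - q))` and
`v = τ (ṽ + r / (1 - s))`, that is
`τ ũ' = τ⁻¹ P(τ, τ (ũ + c), τ (ṽ + d)) - (ũ + c)` with `c = p / (1 - q)`, `d = r / (1 - s)`, and
likewise for `ṽ`. As `P` and `Q` vanish at the origin, `dslope _ 0` is division by `τ`,
with the removable singularity at `τ = 0` filled in. -/
def step (S : BriotBouquet) : BriotBouquet where
  P τ u v :=
    dslope (fun t => S.P t (t * (u + S.p / (1 - S.q))) (t * (v + S.r / (1 - S.s)))) 0 τ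
      - (u + S.p / (1 - S.q))
  Q τ u v :=
    dslope (fun t => S.Q t (t * (u + S.p / (1 - S.q))) (t * (v + S.r / (1 - S.s)))) 0 τ
      - (v + S.r / (1 - S.s))

end BriotBouquet

/-- The system satisfied by `u`, `v` when the curve `(x(y), y, z(y)) = (y u(y), y, y v(y))` is
tangent to the vector field `X = (F, G, H)`: from `G x' = F` and `G z' = H`,
`y u' = (F / y) / (G / y) - u` and `y v' = (H / y) / (G / y) - v`,
with `F`, `G`, `H` evaluated at `(y u, y, y v)`. -/
def alongY (X : Phase → Phase) : BriotBouquet where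
  P y u v :=
    dslope (fun t => X ![t * u, t, t * v] 0) 0 y / dslope (fun t => X ![t * u, t, t * v] 1) 0 y - u
  Q y u v :=
    dslope (fun t => X ![t * u, t, t * v] 2) 0 y / dslope (fun t => X ![t * u, t, t * v] 1) 0 y - v

/-- The system satisfied by `u`, `v` when the curve `(x, y(x), z(x)) = (x, x u(x), x v(x))` is
tangent to the vector field `X = (F, G, H)`: from `F y' = G` and `F z' = H`,
`x u' = (G / x) / (F / x) - u` and `x v' = (H / x) / (F / x) - v`,
with `F`, `G`, `H` evaluated at `(x, x u, x v)`. -/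
def alongX (X : Phase → Phase) : BriotBouquet where
  P x u v :=
    dslope (fun t => X ![t, t * u, t * v] 1) 0 x / dslope (fun t => X ![t, t * u, t * v] 0) 0 x - u
  Q x u v :=
    dslope (fun t => X ![t, t * u, t * v] 2) 0 x / dslope (fun t => X ![t, t * u, t * v] 0) 0 x - v

/-- The number `r̄` for `ω₂ / ω₁ = n ≥ 2`: the coefficient of `y` in the second equation of the
system along the `y`-axis after `n - 2` changes of variables. -/
def rBar (X : Phase → Phase) (n : ℕ) : ℂ := (BriotBouquet.step^[n - 2] (alongY X)).r

/-- The number `r̂` for `ω₂ / ω₁ = n ≥ 2`: the coefficient of `x` in the second equation of the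
system along the `x`-axis after `n - 2` changes of variables. -/
def rHat (X : Phase → Phase) (n : ℕ) : ℂ := (BriotBouquet.step^[n - 2] (alongX X)).r

end CenterFamily

end

namespace CenterFamily

/-! A center family comes from a disc `φ` with `I * ω * s • φ' = X(φ)`: the flow on it is the
rotation `s ↦ exp (I ω t) s`, so all nonzero orbits have least period `2π/|ω|`. With `Y = X / (I ω)`
this is the Briot–Bouquet equation `s φ' = Y(φ)`. It has a holomorphic solution with `φ'(0) = c`
whenever `DY(0) c = c` and no integer `k ≥ 2` is an eigenvalue of `DY(0)`
(`exists_solution_of_eigenvector`): the power series can be solved to any order, and Picard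
iteration started at a truncation of high order converges.

For `ω = ω₂` the condition holds because `|ω₁| ≤ |ω₂|`. For `ω = ω₁` it can fail only when `ω₂ = n
ω₁`; otherwise every direction of the `(x,y)`-plane is tangent to such a disc, which gives
infinitely many.

In the resonant case the discs tangent to the `y`-axis are sought as `(y u, y, y v)`. The system for
`u`, `v` has diagonal coefficients `0` and `n - 1`, and each change of unknowns lowers both by `1`,
so `n - 2` of them lead to `-(n - 2)` and `1`. Joining the equation `s τ' = τ` for the curve
variable gives an autonomous system with eigenvalues `1`, `-(n - 2)`, `1`. If `r̄ = 0`, the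
eigenvalue `1` has a two-dimensional eigenspace, so the slope of `v` is a free parameter
(`IsDiagonal.exists_solution_of_resonance`). Undoing the substitutions keeps the germs distinct, and
a change of parameter makes the motion linear (`exists_linearizedCurve_of_solution`). Exchanging `x`
and `y` turns `r̂` into `r̄`. -/

open Filter Set Asymptotics

/-! ### Cauchy estimates and division by a variable. -/

section Cauchy

variable {E F : Type*} [NormedAddCommGroup E] [NormedSpace ℂ E]
  [NormedAddCommGroup F] [NormedSpace ℂ F]

/-- A function which is complex differentiable near a point has a derivative which is continuous
at that point. -/
theorem continuousAt_fderiv_of_eventually_differentiableAt {f : E → F} {x : E}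
    (hf : ∀ᶠ y in 𝓝 x, DifferentiableAt ℂ f y) : ContinuousAt (fderiv ℂ f) x := by
  rw [Metric.continuousAt_iff']
  intro ε hε
  have hlit := hf.self_of_nhds.hasFDerivAt.isLittleO.def (show 0 < ε / 8 by positivity)
  obtain ⟨δ, hδ, hball⟩ := Metric.eventually_nhds_iff_ball.1 (hf.and hlit)
  filter_upwards [ball_mem_nhds x (half_pos hδ)] with y hy
  have hsub : ball y (δ / 2) ⊆ ball x δ := by
    intro z hz
    rw [mem_ball] at *
    linarith [dist_triangle z y x]
  set A := fderiv ℂ f x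
  have hg : ∀ z ∈ ball x δ, DifferentiableAt ℂ (fun w => f w - A w) z := fun z hz =>
    (hball z hz).1.sub A.differentiableAt
  have hmaps : MapsTo (fun w => f w - A w) (ball y (δ / 2))
      (closedBall (f y - A y) (ε / 8 * (2 * δ))) := by
    intro z hz
    have h1 := (hball z (hsub hz)).2
    have h2 := (hball y (hsub (mem_ball_self (half_pos hδ)))).2
    have h3 : ‖z - x‖ ≤ δ := by simpa [dist_eq_norm] using (mem_ball.1 (hsub hz)).le
    have h4 : ‖y - x‖ ≤ δ := by
      rw [← dist_eq_norm]; exact (mem_ball.1 hy).le.trans (by linarith)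
    rw [mem_closedBall, dist_eq_norm]
    calc ‖f z - A z - (f y - A y)‖
        = ‖(f z - f x - A (z - x)) - (f y - f x - A (y - x))‖ := by
          congr 1; simp only [map_sub]; abel
      _ ≤ ‖f z - f x - A (z - x)‖ + ‖f y - f x - A (y - x)‖ := norm_sub_le _ _
      _ ≤ ε / 8 * δ + ε / 8 * δ := by
          gcongr
          · exact h1.trans (by gcongr)
          · exact h2.trans (by gcongr)
      _ = ε / 8 * (2 * δ) := by ring
  -- Cauchy estimate for `f - A`: its values on a ball of radius `δ / 2` stay within `ε δ / 4` of
  -- the value at `y`, so the derivatives at `y` and `x` differ by at most `ε / 2`.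
  have key := norm_fderiv_le_div_of_mapsTo_ball
    (fun z hz => (hg z (hsub hz)).differentiableWithinAt) hmaps (half_pos hδ)
  have hy' := hball y (hsub (mem_ball_self (half_pos hδ)))
  rw [fderiv_fun_sub hy'.1 A.differentiableAt, A.fderiv] at key
  rw [dist_eq_norm]
  refine key.trans_lt ?_
  rw [div_lt_iff₀ (half_pos hδ)]
  nlinarith [mul_pos hε hδ]

theorem hasStrictFDerivAt_of_eventually_differentiableAt {f : E → F} {x : E}
    (hf : ∀ᶠ y in 𝓝 x, DifferentiableAt ℂ f y) : HasStrictFDerivAt f (fderiv ℂ f x) x :=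
  hasStrictFDerivAt_of_hasFDerivAt_of_continuousAt (hf.mono fun _ h => h.hasFDerivAt)
    (continuousAt_fderiv_of_eventually_differentiableAt hf)

/-- A circle integral depends holomorphically on a parameter. -/
theorem differentiableAt_circleIntegral [CompleteSpace F] {f : E × ℂ → F} {x₀ : E} {c : ℂ} {R : ℝ}
    (hR : 0 ≤ R)
    (hf : ∀ ζ ∈ sphere c R, ∀ᶠ y in 𝓝 (x₀, ζ), DifferentiableAt ℂ f y) :
    DifferentiableAt ℂ (fun x => ∮ ζ in C(c, R), f (x, ζ)) x₀ := by
  let V : Set (E × ℂ) := {y | ∀ᶠ z in 𝓝 y, DifferentiableAt ℂ f z}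
  have hVo : IsOpen V := isOpen_setOfPred_eventually_nhds
  have hVd : ∀ y ∈ V, DifferentiableAt ℂ f y := fun y hy => hy.self_of_nhds
  have hVc : ContinuousOn (fderiv ℂ f) V := fun y hy =>
    (continuousAt_fderiv_of_eventually_differentiableAt hy).continuousWithinAt
  have hK : IsCompact (({x₀} : Set E) ×ˢ sphere c R) := isCompact_singleton.prod (isCompact_sphere c R)
  have hKV : ({x₀} : Set E) ×ˢ sphere c R ⊆ V := by
    rintro ⟨x, ζ⟩ ⟨hx, hζ⟩
    rw [mem_singleton_iff] at hx
    subst hx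
    exact hf ζ hζ
  obtain ⟨B, hB⟩ := hK.exists_bound_of_continuousOn (hVc.mono hKV)
  have hWo : IsOpen (V ∩ (fun y => ‖fderiv ℂ f y‖) ⁻¹' Iio (B + 1)) :=
    hVc.norm.isOpen_inter_preimage hVo isOpen_Iio
  -- Compactness of the circle makes the bound on the derivative uniform for all parameters in one
  -- neighbourhood `u`; this is the domination needed to differentiate under the integral.
  obtain ⟨u, v, huo, hvo, hxu, hsv, huv⟩ := generalized_tube_lemma isCompact_singleton
    (isCompact_sphere c R) hWo (fun y hy => ⟨hKV hy, (hB y hy).trans_lt (lt_add_one B)⟩)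
  have hu : u ∈ 𝓝 x₀ := huo.mem_nhds (hxu rfl)
  have hcirc : ∀ θ, circleMap c R θ ∈ sphere c R := fun θ => circleMap_mem_sphere c hR θ
  have hmem : ∀ x ∈ u, ∀ θ, (x, circleMap c R θ) ∈ V ∩ (fun y => ‖fderiv ℂ f y‖) ⁻¹' Iio (B + 1) :=
    fun x hx θ => huv ⟨hx, hsv (hcirc θ)⟩
  have hdc : Continuous (deriv (circleMap c R)) := by
    rw [funext (deriv_circleMap c R)]
    fun_prop
  have hcont : ∀ x ∈ u, Continuous fun θ : ℝ =>
      deriv (circleMap c R) θ • f (x, circleMap c R θ) := by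
    intro x hx
    refine Continuous.smul hdc ?_
    rw [continuous_iff_continuousAt]
    intro θ
    exact ContinuousAt.comp (f := fun θ => (x, circleMap c R θ)) (g := f)
      (hVd _ (hmem x hx θ).1).continuousAt (by fun_prop)
  let F' : E → ℝ → E →L[ℂ] F := fun x θ =>
    deriv (circleMap c R) θ • (fderiv ℂ f (x, circleMap c R θ)).comp (ContinuousLinearMap.inl ℂ E ℂ)
  have hF'c : Continuous (F' x₀) := by
    refine Continuous.smul hdc ?_
    refine Continuous.clm_comp ?_ continuous_const
    rw [continuous_iff_continuousAt]
    intro θ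
    exact ContinuousAt.comp (f := fun θ => (x₀, circleMap c R θ)) (g := fderiv ℂ f)
      (continuousAt_fderiv_of_eventually_differentiableAt (hmem x₀ (hxu rfl) θ).1) (by fun_prop)
  have key := intervalIntegral.hasFDerivAt_integral_of_dominated_of_fderiv_le (𝕜 := ℂ)
    (μ := MeasureTheory.volume) (a := 0) (b := 2 * Real.pi) (s := u) (x₀ := x₀)
    (F := fun x θ => deriv (circleMap c R) θ • f (x, circleMap c R θ)) (F' := F')
    (bound := fun _ => R * ((B + 1) * ‖ContinuousLinearMap.inl ℂ E ℂ‖)) hu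
    (by filter_upwards [hu] with x hx using (hcont x hx).aestronglyMeasurable)
    ((hcont x₀ (hxu rfl)).intervalIntegrable _ _)
    hF'c.aestronglyMeasurable
    (.of_forall fun θ _ x hx => by
      have h1 : ‖deriv (circleMap c R) θ‖ = R := by
        simp [deriv_circleMap, abs_of_nonneg hR]
      have h2 : ‖fderiv ℂ f (x, circleMap c R θ)‖ ≤ B + 1 := (hmem x hx θ).2.le
      simp only [F']
      rw [norm_smul, h1]
      gcongr
      exact (ContinuousLinearMap.opNorm_comp_le _ _).trans (by gcongr))
    (by simp)
    (.of_forall fun θ _ x hx => by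
      refine HasFDerivAt.const_smul (c := deriv (circleMap c R) θ) ?_
      have h1 := (hVd _ (hmem x hx θ).1).hasFDerivAt
      exact HasFDerivAt.comp x h1 ((hasFDerivAt_id x).prodMk (hasFDerivAt_const _ x)))
  exact key.differentiableAt

/-- Division by the first variable, with the removable singularity filled in, preserves
holomorphy in all the variables. -/
theorem eventually_differentiableAt_dslope [CompleteSpace F] {f : ℂ × E → F} {e₀ : E}
    (hf : ∀ᶠ x in 𝓝 ((0 : ℂ), e₀), DifferentiableAt ℂ f x) :
    ∀ᶠ x in 𝓝 ((0 : ℂ), e₀),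
      DifferentiableAt ℂ (fun x : ℂ × E => dslope (fun t => f (t, x.2)) 0 x.1) x := by
  obtain ⟨r, hr, hball⟩ := Metric.eventually_nhds_iff_ball.1 hf
  rw [← ball_prod_same] at hball
  set R := r / 2 with hRdef
  have hR : 0 < R := half_pos hr
  have hopen : IsOpen (ball (0 : ℂ) R ×ˢ ball e₀ r) := isOpen_ball.prod isOpen_ball
  have hclosed : closedBall (0 : ℂ) R ⊆ ball 0 r := closedBall_subset_ball (by linarith)
  have hslice : ∀ e ∈ ball e₀ r, DifferentiableOn ℂ (dslope (fun t => f (t, e)) 0) (ball 0 r) := by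
    intro e he
    rw [Complex.differentiableOn_dslope (ball_mem_nhds _ hr)]
    intro t ht
    exact ((hball (t, e) ⟨ht, he⟩).comp t (f := fun t => (t, e))
      (by fun_prop)).differentiableWithinAt
  -- Cauchy's formula recovers the quotient from its values on `|ζ| = R`, where dividing by `ζ` is
  -- harmless, so the integrand is holomorphic in all variables.
  have hcauchy : ∀ x ∈ ball (0 : ℂ) R ×ˢ ball e₀ r,
      dslope (fun t => f (t, x.2)) 0 x.1 = (2 * Real.pi * I : ℂ)⁻¹ •
        ∮ ζ in C(0, R), (ζ - x.1)⁻¹ • (ζ⁻¹ • (f (ζ, x.2) - f (0, x.2))) := by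
    rintro ⟨t, e⟩ ⟨ht, he⟩
    have h1 := ((hslice e he).mono hclosed).circleIntegral_sub_inv_smul ht
    have h2 : (∮ ζ in C(0, R), (ζ - t)⁻¹ • (ζ⁻¹ • (f (ζ, e) - f (0, e)))) =
        ∮ ζ in C(0, R), (ζ - t)⁻¹ • dslope (fun t => f (t, e)) 0 ζ := by
      refine circleIntegral.integral_congr hR.le fun ζ hζ => ?_
      have h0 : ζ ≠ 0 := ne_zero_of_mem_sphere hR.ne' ⟨ζ, hζ⟩
      simp [dslope_of_ne _ h0, slope_def_module]
    simp only
    rw [h2, h1, smul_smul, inv_mul_cancel₀ (by simp [Real.pi_ne_zero]), one_smul]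
  have hx₀ : ((0 : ℂ), e₀) ∈ ball (0 : ℂ) R ×ˢ ball e₀ r := ⟨mem_ball_self hR, mem_ball_self hr⟩
  filter_upwards [hopen.mem_nhds hx₀] with x hx
  have hev : (fun x : ℂ × E => dslope (fun t => f (t, x.2)) 0 x.1) =ᶠ[𝓝 x] fun x =>
      (2 * Real.pi * I : ℂ)⁻¹ •
        ∮ ζ in C(0, R), (ζ - x.1)⁻¹ • (ζ⁻¹ • (f (ζ, x.2) - f (0, x.2))) := by
    filter_upwards [hopen.mem_nhds hx] with y hy using hcauchy y hy
  refine DifferentiableAt.congr_of_eventuallyEq ?_ hev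
  refine DifferentiableAt.const_smul ?_ _
  refine differentiableAt_circleIntegral (E := ℂ × E)
    (f := fun y => (y.2 - y.1.1)⁻¹ • (y.2⁻¹ • (f (y.2, y.1.2) - f (0, y.1.2)))) hR.le ?_
  intro ζ hζ
  have hζ0 : ζ ≠ 0 := ne_zero_of_mem_sphere hR.ne' ⟨ζ, hζ⟩
  have hζx : ζ - x.1 ≠ 0 := by
    intro h
    have h1 : ‖x.1‖ < R := by simpa using hx.1
    rw [← sub_eq_zero.1 h] at h1
    simp only [mem_sphere_iff_norm, sub_zero] at hζ
    exact h1.ne hζ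
  have e1 : ∀ᶠ y : (ℂ × E) × ℂ in 𝓝 (x, ζ), y.2 ≠ 0 :=
    ContinuousAt.eventually_ne (g := fun y : (ℂ × E) × ℂ => y.2) (by fun_prop) hζ0
  have e2 : ∀ᶠ y : (ℂ × E) × ℂ in 𝓝 (x, ζ), y.2 - y.1.1 ≠ 0 :=
    ContinuousAt.eventually_ne (g := fun y : (ℂ × E) × ℂ => y.2 - y.1.1) (by fun_prop) hζx
  have e3 : ∀ᶠ y : (ℂ × E) × ℂ in 𝓝 (x, ζ), y.2 ∈ ball (0 : ℂ) r :=
    ContinuousAt.eventually_mem (f := fun y : (ℂ × E) × ℂ => y.2) (by fun_prop)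
      (isOpen_ball.mem_nhds (hclosed (sphere_subset_closedBall hζ)))
  have e4 : ∀ᶠ y : (ℂ × E) × ℂ in 𝓝 (x, ζ), y.1.2 ∈ ball e₀ r :=
    ContinuousAt.eventually_mem (f := fun y : (ℂ × E) × ℂ => y.1.2) (by fun_prop)
      (isOpen_ball.mem_nhds hx.2)
  filter_upwards [e1, e2, e3, e4] with y h1 h2 h3 h4
  have d1 : DifferentiableAt ℂ (fun y : (ℂ × E) × ℂ => f (y.2, y.1.2)) y :=
    (hball (y.2, y.1.2) ⟨h3, h4⟩).comp y (f := fun y : (ℂ × E) × ℂ => (y.2, y.1.2)) (by fun_prop)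
  have d2 : DifferentiableAt ℂ (fun y : (ℂ × E) × ℂ => f (0, y.1.2)) y :=
    (hball (0, y.1.2) ⟨mem_ball_self hr, h4⟩).comp y
      (f := fun y : (ℂ × E) × ℂ => ((0 : ℂ), y.1.2)) (by fun_prop)
  have d3 : DifferentiableAt ℂ (fun y : (ℂ × E) × ℂ => (y.2)⁻¹) y :=
    DifferentiableAt.inv (by fun_prop) h1
  have d4 : DifferentiableAt ℂ (fun y : (ℂ × E) × ℂ => (y.2 - y.1.1)⁻¹) y :=
    DifferentiableAt.inv (by fun_prop) h2
  exact d4.smul (d3.smul (d1.sub d2))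

end Cauchy


/-! ### Briot–Bouquet equations: formal solution and convergence. -/

section BriotBouquetEquation

variable {E : Type*} [NormedAddCommGroup E] [NormedSpace ℂ E]

theorem exists_eventuallyEq_pow_smul_of_isBigO {f : ℂ → E} {n : ℕ} (hf : AnalyticAt ℂ f 0)
    (h : f =O[𝓝 0] fun s => s ^ n) :
    ∃ g : ℂ → E, AnalyticAt ℂ g 0 ∧ ∀ᶠ s in 𝓝 0, f s = s ^ n • g s := by
  by_cases hz : ∀ᶠ s in 𝓝 0, f s = 0
  · exact ⟨fun _ => 0, analyticAt_const, by simpa using hz⟩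
  obtain ⟨k, g, hg, hg0, hfg⟩ := hf.exists_eventuallyEq_pow_smul_nonzero_iff.2 hz
  simp only [sub_zero] at hfg
  rcases le_or_gt n k with hnk | hkn
  · refine ⟨fun s => s ^ (k - n) • g s, by fun_prop, ?_⟩
    filter_upwards [hfg] with s hs
    rw [hs, smul_smul, ← pow_add, Nat.add_sub_cancel' hnk]
  · exfalso
    apply hg0
    have h1 : g =O[𝓝[≠] 0] fun s : ℂ => s ^ (n - k) := by
      have h2 : (fun s : ℂ => (s ^ k)⁻¹ • f s) =O[𝓝[≠] 0] fun s => (s ^ k)⁻¹ • s ^ n :=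
        (isBigO_refl _ _).smul (h.mono nhdsWithin_le_nhds)
      refine h2.congr' ?_ ?_
      · filter_upwards [hfg.filter_mono nhdsWithin_le_nhds, self_mem_nhdsWithin] with s hs hs0
        rw [hs, smul_smul, inv_mul_cancel₀ (pow_ne_zero _ hs0), one_smul]
      · filter_upwards [self_mem_nhdsWithin] with s hs0
        have hs0' : s ≠ 0 := hs0
        rw [smul_eq_mul, ← pow_sub_mul_pow s hkn.le]
        field_simp
    have h3 : Tendsto (fun s : ℂ => s ^ (n - k)) (𝓝[≠] 0) (𝓝 0) := by
      have : Tendsto (fun s : ℂ => s ^ (n - k)) (𝓝 0) (𝓝 (0 ^ (n - k))) :=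
        (continuous_pow _).tendsto _
      rw [zero_pow (by omega)] at this
      exact this.mono_left nhdsWithin_le_nhds
    exact tendsto_nhds_unique (hg.continuousAt.tendsto.mono_left nhdsWithin_le_nhds)
      (h1.trans_tendsto h3)

/-- The order of vanishing of an analytic function is an integer or infinite. This lets each
correction of an approximate solution gain a whole order. -/
theorem isBigO_pow_succ_of_isLittleO {f : ℂ → E} {n : ℕ} (hf : AnalyticAt ℂ f 0)
    (h : f =o[𝓝 0] fun s => s ^ n) : f =O[𝓝 0] fun s => s ^ (n + 1) := by
  obtain ⟨g, hg, hfg⟩ := exists_eventuallyEq_pow_smul_of_isBigO hf h.isBigO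
  have hg0 : g 0 = 0 := by
    have h1 : (fun s : ℂ => (s ^ n)⁻¹ • f s) =o[𝓝[≠] 0] fun s => (s ^ n)⁻¹ • s ^ n :=
      (isBigO_refl _ _).smul_isLittleO (h.mono nhdsWithin_le_nhds)
    have h2 : g =o[𝓝[≠] 0] fun _ => (1 : ℂ) := by
      refine h1.congr' ?_ ?_
      · filter_upwards [hfg.filter_mono nhdsWithin_le_nhds, self_mem_nhdsWithin] with s hs hs0
        rw [hs, smul_smul, inv_mul_cancel₀ (pow_ne_zero _ hs0), one_smul]
      · filter_upwards [self_mem_nhdsWithin] with s hs0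
        rw [smul_eq_mul, inv_mul_cancel₀ (pow_ne_zero _ hs0)]
    exact tendsto_nhds_unique (hg.continuousAt.tendsto.mono_left nhdsWithin_le_nhds)
      ((isLittleO_one_iff ℂ).1 h2)
  have h3 : g =O[𝓝 0] fun s : ℂ => s := by
    simpa [hg0] using hg.differentiableAt.isBigO_sub
  refine ((isBigO_refl (fun s : ℂ => s ^ n) (𝓝 0)).smul h3).congr' ?_ ?_
  · filter_upwards [hfg] with s hs using hs.symm
  · exact .of_forall fun s => by simp [pow_succ]

variable [CompleteSpace E]

theorem analyticAt_of_eventually_differentiableAt {f : ℂ → E} {z : ℂ}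
    (hf : ∀ᶠ s in 𝓝 z, DifferentiableAt ℂ f s) : AnalyticAt ℂ f z :=
  Complex.analyticAt_iff_eventually_differentiableAt.2 hf

/-- The power series solutions of `s φ' = Y(φ)`, truncated at an arbitrary order. -/
theorem exists_approximate_solution {Y : E → E} (hY : ∀ᶠ w in 𝓝 0, DifferentiableAt ℂ Y w)
    (hY0 : Y 0 = 0) {c : E} (hc : fderiv ℂ Y 0 c = c)
    (hk : ∀ k : ℕ, 2 ≤ k → ∀ b, ∃ a, (k : ℂ) • a - fderiv ℂ Y 0 a = b) (n : ℕ) :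
    ∃ p : ℂ → E, Differentiable ℂ p ∧ p 0 = 0 ∧ deriv p 0 = c ∧
      (fun s => s • deriv p s - Y (p s)) =O[𝓝 0] fun s => s ^ (n + 2) := by
  have han : ∀ p : ℂ → E, Differentiable ℂ p → p 0 = 0 → AnalyticAt ℂ (fun s => Y (p s)) 0 := by
    intro p hp hp0
    apply analyticAt_of_eventually_differentiableAt
    have h1 : Tendsto p (𝓝 0) (𝓝 0) := by
      simpa [hp0] using hp.continuous.tendsto 0
    filter_upwards [h1.eventually hY] with s hs using hs.comp s (hp s)
  have hres : ∀ p : ℂ → E, Differentiable ℂ p → p 0 = 0 →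
      AnalyticAt ℂ (fun s => s • deriv p s - Y (p s)) 0 := fun p hp hp0 =>
    (analyticAt_id.smul (hp.analyticAt 0).deriv).sub (han p hp hp0)
  induction n with
  | zero =>
    have hd : Differentiable ℂ fun s : ℂ => s • c := by fun_prop
    have hderiv : ∀ s : ℂ, deriv (fun s : ℂ => s • c) s = c := fun s => by
      simpa using ((hasDerivAt_id s).smul_const c).deriv
    refine ⟨fun s => s • c, hd, by simp, hderiv 0, ?_⟩
    have hr := hres _ hd (by simp)
    refine isBigO_pow_succ_of_isLittleO (n := 1) hr ?_
    simp only [hderiv]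
    have h1 : HasDerivAt (fun s : ℂ => s • c - Y (s • c)) (c - fderiv ℂ Y 0 c) 0 := by
      have h2 : HasDerivAt (fun s : ℂ => s • c) c 0 := by
        simpa using (hasDerivAt_id (0 : ℂ)).smul_const c
      refine h2.sub ?_
      refine HasFDerivAt.comp_hasDerivAt (0 : ℂ) ?_ h2
      simpa using hY.self_of_nhds.hasFDerivAt
    rw [hc, sub_self] at h1
    simpa [hasDerivAt_iff_isLittleO, hY0] using h1
  | succ n ih =>
    obtain ⟨p, hp, hp0, hpc, hO⟩ := ih
    set m := n + 2 with hm
    obtain ⟨g, hg, hgr⟩ := exists_eventuallyEq_pow_smul_of_isBigO (hres p hp hp0) hO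
    -- Adding `s ^ m • a` changes the coefficient of `s ^ m` in the residual by `m a - DY(0) a`;
    -- this `a` cancels the leading coefficient `g 0`.
    obtain ⟨a, ha⟩ := hk m (by omega) (-g 0)
    set q : ℂ → E := fun s => p s + s ^ m • a with hq
    have hqd : Differentiable ℂ q := by fun_prop
    have hq0 : q 0 = 0 := by simp [hq, hp0, hm]
    have hqder : ∀ s, deriv q s = deriv p s + (m * s ^ (m - 1)) • a := by
      intro s
      exact ((hp s).hasDerivAt.add ((hasDerivAt_pow m s).smul_const a)).deriv
    refine ⟨q, hqd, hq0, ?_, ?_⟩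
    · rw [hqder, hpc]
      simp [hm]
    · refine isBigO_pow_succ_of_isLittleO (n := m) (hres q hqd hq0) ?_
      -- Strict differentiability is essential: the linearization error is small relative to `q -
      -- p`, that is `o(s ^ m)`, whereas differentiability at `0` would only give `o(s)`.
      have hs := (hasStrictFDerivAt_of_eventually_differentiableAt hY).isLittleO
      have ht : Tendsto (fun s => (q s, p s)) (𝓝 0) (𝓝 ((0 : E), (0 : E))) := by
        have h1 := hqd.continuous.tendsto 0
        have h2 := hp.continuous.tendsto 0
        rw [hq0] at h1
        rw [hp0] at h2
        exact h1.prodMk_nhds h2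
      have h1 := hs.comp_tendsto ht
      have h2 : (fun s => Y (q s) - Y (p s) - fderiv ℂ Y 0 (s ^ m • a)) =o[𝓝 0]
          fun s : ℂ => s ^ m := by
        have h3 : (fun s : ℂ => s ^ m • a) =O[𝓝 0] fun s : ℂ => s ^ m := by
          refine IsBigO.of_bound ‖a‖ (.of_forall fun s => ?_)
          rw [norm_smul, mul_comm]
        refine IsLittleO.trans_isBigO ?_ h3
        simpa [Function.comp_def, hq] using h1
      have h4 : (fun s => s ^ m • (g s - g 0)) =o[𝓝 0] fun s : ℂ => s ^ m := by
        have h5 : (fun s => g s - g 0) =o[𝓝 0] fun _ : ℂ => (1 : ℂ) := by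
          rw [isLittleO_one_iff]
          simpa using hg.continuousAt.tendsto.sub_const (g 0)
        simpa using (isBigO_refl (fun s : ℂ => s ^ m) (𝓝 0)).smul_isLittleO h5
      refine (h4.sub h2).congr' ?_ .rfl
      filter_upwards [hgr] with s hs
      have h6 : g 0 = fderiv ℂ Y 0 a - (m : ℂ) • a := by rw [← neg_sub, ha, neg_neg]
      have h7 : Y (p s) = s • deriv p s - s ^ m • g s := by rw [← hs]; abel
      have h8 : s • ((m * s ^ (m - 1)) • a) = s ^ m • ((m : ℂ) • a) := by
        rw [smul_smul, smul_smul]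
        congr 1
        rw [show s ^ m = s * s ^ (m - 1) by rw [← pow_succ', Nat.sub_add_cancel (by omega)]]
        ring
      rw [hqder, h7, h6, smul_add, h8, map_smul]
      simp only [smul_sub]
      abel

theorem exists_primitive_div {h : ℂ → E} {ρ : ℝ} (hρ : 0 < ρ) (hh : DifferentiableOn ℂ h (ball 0 ρ))
    (h0 : h 0 = 0) :
    ∃ g : ℂ → E, DifferentiableOn ℂ g (ball 0 ρ) ∧ g 0 = 0 ∧
      ∀ s ∈ ball 0 ρ, s • deriv g s = h s := by
  have hd : DifferentiableOn ℂ (dslope h 0) (ball 0 ρ) :=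
    (Complex.differentiableOn_dslope (ball_mem_nhds _ hρ)).2 hh
  obtain ⟨g, hg0, hg⟩ := hd.isExactOn_ball.with_val_at 0 0
  refine ⟨g, fun s hs => (hg s hs).differentiableAt.differentiableWithinAt, hg0, fun s hs => ?_⟩
  rw [(hg s hs).deriv]
  simpa [h0] using sub_smul_dslope h 0 s

/-- Integrating `K t ^ (M - 1)` along the ray from `0` to `s` gains the factor `1 / M`, which beats
the Lipschitz constant of `Y` once `M` is large. -/
theorem norm_le_of_norm_smul_deriv_le {h : ℂ → E} {ρ K : ℝ} {M : ℕ} (hM : 2 ≤ M)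
    (hh : DifferentiableOn ℂ h (ball 0 ρ)) (h0 : h 0 = 0)
    (hb : ∀ s ∈ ball 0 ρ, ‖s • deriv h s‖ ≤ K * ‖s‖ ^ M) :
    ∀ s ∈ ball 0 ρ, ‖h s‖ ≤ K / M * ‖s‖ ^ M := by
  intro s hs
  have hρ : 0 < ρ := pos_of_mem_ball hs
  have hder : ∀ t ∈ ball (0 : ℂ) ρ, HasDerivAt h (deriv h t) t := fun t ht =>
    (hh.differentiableAt (isOpen_ball.mem_nhds ht)).hasDerivAt
  have hb' : ∀ t ∈ ball (0 : ℂ) ρ, ‖deriv h t‖ ≤ K * ‖t‖ ^ (M - 1) := by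
    have hne : ∀ t ∈ ball (0 : ℂ) ρ, t ≠ 0 → ‖deriv h t‖ ≤ K * ‖t‖ ^ (M - 1) := by
      intro t ht ht0
      have h1 := hb t ht
      rw [norm_smul, ← Nat.sub_add_cancel (show 1 ≤ M by omega), pow_succ] at h1
      have h2 : 0 < ‖t‖ := norm_pos_iff.2 ht0
      nlinarith
    intro t ht
    rcases eq_or_ne t 0 with rfl | ht0
    · have hc : ContinuousAt (deriv h) 0 :=
        ((hh.deriv isOpen_ball).differentiableAt (ball_mem_nhds _ hρ)).continuousAt
      have hc' : ContinuousAt (fun t : ℂ => K * ‖t‖ ^ (M - 1)) 0 := by fun_prop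
      refine le_of_tendsto_of_tendsto (hc.norm.tendsto.mono_left (nhdsWithin_le_nhds (s := {0}ᶜ)))
        (hc'.tendsto.mono_left nhdsWithin_le_nhds) ?_
      filter_upwards [self_mem_nhdsWithin, nhdsWithin_le_nhds (ball_mem_nhds _ hρ)] with t h1 h2
        using hne t h2 h1
    · exact hne t ht ht0
  have hmem : ∀ t ∈ Icc (0 : ℝ) 1, (t : ℂ) * s ∈ ball (0 : ℂ) ρ := by
    intro t ht
    rw [mem_ball_zero_iff] at *
    rw [norm_mul, Complex.norm_real, Real.norm_of_nonneg ht.1]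
    nlinarith [ht.2, norm_nonneg s]
  have hf : ∀ t ∈ Icc (0 : ℝ) 1, HasDerivAt (fun t : ℝ => h (t * s)) (s • deriv h (t * s)) t := by
    intro t ht
    have h1 : HasDerivAt (fun t : ℝ => (t : ℂ) * s) s t := by
      simpa using (Complex.ofRealCLM.hasDerivAt (x := t)).mul_const s
    exact (hder _ (hmem t ht)).scomp t h1
  have hM0 : (M : ℝ) ≠ 0 := by positivity
  have key := image_norm_le_of_norm_deriv_right_le_deriv_boundary (E := E)
    (f := fun t : ℝ => h (t * s)) (a := 0) (b := 1)
    (B := fun t => K / M * ‖s‖ ^ M * t ^ M) (B' := fun t => K / M * ‖s‖ ^ M * (M * t ^ (M - 1)))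
    (fun t ht => (hf t ht).continuousAt.continuousWithinAt)
    (fun t ht => (hf t (Ico_subset_Icc_self ht)).hasDerivWithinAt)
    (by simp [h0, show M ≠ 0 by omega])
    (fun t => (hasDerivAt_pow M t).const_mul _)
    (fun t ht => by
      have h1 := hb' _ (hmem t (Ico_subset_Icc_self ht))
      rw [norm_smul]
      rw [norm_mul, Complex.norm_real, Real.norm_of_nonneg ht.1] at h1
      calc ‖s‖ * ‖deriv h (t * s)‖ ≤ ‖s‖ * (K * (t * ‖s‖) ^ (M - 1)) := by gcongr
        _ = K * (‖s‖ ^ (M - 1) * ‖s‖) * t ^ (M - 1) := by ring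
        _ = K * ‖s‖ ^ M * t ^ (M - 1) := by rw [← pow_succ, Nat.sub_add_cancel (by omega)]
        _ = K / M * ‖s‖ ^ M * (M * t ^ (M - 1)) := by field_simp)
    (right_mem_Icc.2 zero_le_one)
  simpa using key

/-- An approximate solution of `s φ' = Y(φ)` of high enough order lies near a solution. -/
theorem exists_solution_near_approximate_solution {Y : E → E} {V : Set E} (hV : IsOpen V)
    (h0V : (0 : E) ∈ V) (hYV : DifferentiableOn ℂ Y V) (hY0 : Y 0 = 0) {L : NNReal}
    (hL : LipschitzOnWith L Y V) {M : ℕ} (hM2 : 2 ≤ M) (hLM : L + 1 ≤ (M : ℝ))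
    (hLM2 : 2 * L ≤ (M : ℝ)) {p : ℂ → E} (hp : Differentiable ℂ p) (hp0 : p 0 = 0)
    (hres : (fun s => s • deriv p s - Y (p s)) =O[𝓝 0] fun s => s ^ M) :
    ∃ ρ > 0, ∃ φ : ℂ → E, DifferentiableOn ℂ φ (ball 0 ρ) ∧ MapsTo φ (ball 0 ρ) V ∧
      φ 0 = 0 ∧ deriv φ 0 = deriv p 0 ∧ ∀ s ∈ ball 0 ρ, s • deriv φ s = Y (φ s) := by
  obtain ⟨r, hr, hrV⟩ := Metric.isOpen_iff.1 hV 0 h0V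
  obtain ⟨C, hC, hCb⟩ := hres.exists_pos
  rw [isBigOWith_iff] at hCb
  have hM0 : (0 : ℝ) < M := by positivity
  -- a radius on which all the iterates are defined
  have hsmall : ∀ᶠ s : ℂ in 𝓝 0, ‖p s‖ < r / 2 ∧ C * ‖s‖ ^ M < r / 2 ∧
      ‖s • deriv p s - Y (p s)‖ ≤ C * ‖s ^ M‖ := by
    refine (ContinuousAt.eventually_lt hp.continuous.norm.continuousAt (by fun_prop) (by simp [hp0, hr])).and
      ((ContinuousAt.eventually_lt (by fun_prop) (by fun_prop) ?_).and hCb)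
    simp [hr, show M ≠ 0 by omega]
  obtain ⟨ρ₀, hρ₀, hball₀⟩ := Metric.eventually_nhds_iff_ball.1 hsmall
  obtain ⟨ρ, hρ, hρρ₀, hρ1⟩ : ∃ ρ > 0, ρ ≤ ρ₀ ∧ ρ ≤ 1 :=
    ⟨min ρ₀ 1, lt_min hρ₀ one_pos, min_le_left _ _, min_le_right _ _⟩
  have hball := fun s (hs : s ∈ ball (0 : ℂ) ρ) => hball₀ s (ball_subset_ball hρρ₀ hs)
  let Good : (ℂ → E) → Prop := fun f => DifferentiableOn ℂ f (ball 0 ρ) ∧ f 0 = 0 ∧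
    ∀ s ∈ ball 0 ρ, ‖f s - p s‖ ≤ C * ‖s‖ ^ M
  have hGV : ∀ f, (∀ s ∈ ball (0 : ℂ) ρ, ‖f s - p s‖ ≤ C * ‖s‖ ^ M) →
      MapsTo f (ball 0 ρ) V := by
    intro f hf s hs
    apply hrV
    rw [mem_ball_zero_iff]
    calc ‖f s‖ = ‖(f s - p s) + p s‖ := by rw [sub_add_cancel]
      _ ≤ ‖f s - p s‖ + ‖p s‖ := norm_add_le _ _
      _ < r / 2 + r / 2 := by
          have := hf s hs
          have := hball s hs
          linarith
      _ = r := by ring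
  have hpV : MapsTo p (ball 0 ρ) V := hGV p fun s _ => by simp; positivity
  -- The Picard map solves `s g' = Y(f)`. It preserves the bound `C ‖s‖ ^ M` on the distance to `p`
  -- because `(L C + C) / M ≤ C`, which is `L + 1 ≤ M`.
  have hstep : ∀ f : {f // Good f}, ∃ g : {f // Good f},
      ∀ s ∈ ball 0 ρ, s • deriv g.1 s = Y (f.1 s) := by
    rintro ⟨f, hfd, hf0, hfb⟩
    obtain ⟨g, hgd, hg0, hg⟩ := exists_primitive_div hρ (hYV.comp hfd (hGV f hfb))
      (by simp [hf0, hY0])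
    refine ⟨⟨g, hgd, hg0, ?_⟩, hg⟩
    have h1 : ∀ s ∈ ball (0 : ℂ) ρ, ‖(fun s => g s - p s) s‖ ≤ (L * C + C) / M * ‖s‖ ^ M := by
      refine norm_le_of_norm_smul_deriv_le hM2 (hgd.sub hp.differentiableOn) (by simp [hg0, hp0]) ?_
      intro s hs
      rw [deriv_fun_sub (hgd.differentiableAt (isOpen_ball.mem_nhds hs)) (hp s), smul_sub, hg s hs]
      have h2 := (hball s hs).2.2
      have h3 := hL.norm_sub_le (hGV f hfb hs) (hpV hs)
      rw [norm_pow] at h2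
      calc ‖Y (f s) - s • deriv p s‖ = ‖(Y (f s) - Y (p s)) - (s • deriv p s - Y (p s))‖ := by
            congr 1; abel
        _ ≤ ‖Y (f s) - Y (p s)‖ + ‖s • deriv p s - Y (p s)‖ := norm_sub_le _ _
        _ ≤ L * (C * ‖s‖ ^ M) + C * ‖s‖ ^ M := by
            gcongr
            exact h3.trans (by gcongr; exact hfb s hs)
        _ = (L * C + C) * ‖s‖ ^ M := by ring
    intro s hs
    refine (h1 s hs).trans ?_
    gcongr
    rw [div_le_iff₀ hM0]
    nlinarith
  choose T hT using hstep
  let φ : ℕ → {f // Good f} := fun n => T^[n] ⟨p, hp.differentiableOn, hp0, fun s _ => by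
    simp; positivity⟩
  have hφ : ∀ n, ∀ s ∈ ball 0 ρ, s • deriv (φ (n + 1)).1 s = Y ((φ n).1 s) := by
    intro n
    simp only [φ, Function.iterate_succ_apply']
    exact hT _
  -- In the norm weighted by `‖s‖ ^ M` the Picard map contracts by `L / M ≤ 1 / 2`.
  have hdiff : ∀ n, ∀ s ∈ ball (0 : ℂ) ρ,
      ‖(φ n).1 s - (φ (n + 1)).1 s‖ ≤ C * (1 / 2) ^ n * ‖s‖ ^ M := by
    intro n
    induction n with
    | zero =>
      intro s hs
      rw [norm_sub_rev]
      simpa only [pow_zero, mul_one] using! (φ 1).2.2.2 s hs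
    | succ n ih =>
      intro s hs
      have h1 := norm_le_of_norm_smul_deriv_le (K := L * (C * (1 / 2) ^ n)) hM2
        ((φ (n + 1)).2.1.sub (φ (n + 1 + 1)).2.1)
        (by simp [(φ (n + 1)).2.2.1, (φ (n + 1 + 1)).2.2.1]) (fun s hs => by
          have hs' := isOpen_ball.mem_nhds hs
          rw [deriv_sub ((φ (n + 1)).2.1.differentiableAt hs')
            ((φ (n + 1 + 1)).2.1.differentiableAt hs'), smul_sub, hφ n s hs, hφ (n + 1) s hs]
          refine (hL.norm_sub_le (hGV _ (φ n).2.2.2 hs) (hGV _ (φ (n + 1)).2.2.2 hs)).trans ?_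
          rw [mul_assoc]
          gcongr
          exact ih s hs) s hs
      refine h1.trans ?_
      gcongr
      rw [div_le_iff₀ hM0, pow_succ]
      have : 0 < C * (1 / 2) ^ n := by positivity
      nlinarith
  have hdist : ∀ s ∈ ball (0 : ℂ) ρ, ∀ n,
      dist ((φ n).1 s) ((φ (n + 1)).1 s) ≤ C * (1 / 2) ^ n := by
    intro s hs n
    rw [dist_eq_norm]
    refine (hdiff n s hs).trans (mul_le_of_le_one_right (by positivity) ?_)
    exact pow_le_one₀ (norm_nonneg _) ((mem_ball_zero_iff.1 hs).le.trans hρ1)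
  have hlim : ∀ s ∈ ball (0 : ℂ) ρ, ∃ a, Tendsto (fun n => (φ n).1 s) atTop (𝓝 a) := fun s hs =>
    cauchySeq_tendsto_of_complete (cauchySeq_of_le_geometric _ _ (by norm_num) (hdist s hs))
  choose! ψ hψ using hlim
  have hunif : TendstoLocallyUniformlyOn (fun n => (φ n).1) ψ atTop (ball 0 ρ) := by
    refine TendstoUniformlyOn.tendstoLocallyUniformlyOn ?_
    rw [Metric.tendstoUniformlyOn_iff]
    intro ε hε
    have h1 : Tendsto (fun n : ℕ => C * (1 / 2 : ℝ) ^ n / (1 - 1 / 2)) atTop (𝓝 0) := by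
      have := (tendsto_pow_atTop_nhds_zero_of_lt_one (r := (1 / 2 : ℝ)) (by norm_num)
        (by norm_num)).const_mul C |>.div_const (1 - 1 / 2)
      simpa using this
    filter_upwards [h1.eventually_lt_const hε] with n hn s hs
    rw [dist_comm]
    exact (dist_le_of_le_geometric_of_tendsto _ _ (by norm_num) (hdist s hs) (hψ s hs) n).trans_lt hn
  have hψd : DifferentiableOn ℂ ψ (ball 0 ρ) :=
    hunif.differentiableOn (.of_forall fun n => (φ n).2.1) isOpen_ball
  have hψb : ∀ s ∈ ball (0 : ℂ) ρ, ‖ψ s - p s‖ ≤ C * ‖s‖ ^ M := fun s hs =>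
    le_of_tendsto ((hψ s hs).sub_const (p s)).norm (.of_forall fun n => (φ n).2.2.2 s hs)
  have hψ0 : ψ 0 = 0 := by
    have := hψb 0 (mem_ball_self hρ)
    simpa [hp0, show M ≠ 0 by omega] using this
  refine ⟨ρ, hρ, ψ, hψd, hGV ψ hψb, hψ0, ?_, ?_⟩
  · have h1 : HasDerivAt (fun s => ψ s - p s) 0 0 := by
      rw [hasDerivAt_iff_isLittleO]
      simp only [hψ0, hp0, sub_zero, smul_zero]
      have h2 : (fun s => ψ s - p s) =O[𝓝 0] fun s : ℂ => s ^ M := by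
        refine IsBigO.of_bound C ?_
        filter_upwards [ball_mem_nhds _ hρ] with s hs
        simpa using hψb s hs
      refine h2.trans_isLittleO ?_
      simpa using isLittleO_pow_pow (𝕜 := ℂ) (show 1 < M by omega)
    have h3 := h1.deriv
    rw [deriv_fun_sub (hψd.differentiableAt (ball_mem_nhds _ hρ)) (hp 0), sub_eq_zero] at h3
    exact h3
  · intro s hs
    have h1 := (hunif.deriv (.of_forall fun n => (φ n).2.1) isOpen_ball).tendsto_at hs
    have h2 : Tendsto (fun n => s • deriv (φ (n + 1)).1 s) atTop (𝓝 (s • deriv ψ s)) :=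
      ((tendsto_add_atTop_iff_nat 1).2 h1).const_smul s
    have h3 : Tendsto (fun n => Y ((φ n).1 s)) atTop (𝓝 (Y (ψ s))) := by
      have h4 := hGV ψ hψb hs
      exact ((hYV.differentiableAt (hV.mem_nhds h4)).continuousAt.tendsto).comp (hψ s hs)
    refine tendsto_nhds_unique h2 (h3.congr fun n => (hφ n s hs).symm)

/-- **Briot–Bouquet equations.** If `1` is an eigenvalue of the derivative of `Y` at its zero `0`
and none of `2, 3, …` is a spectral value, then `s φ' = Y(φ)` has a holomorphic solution with
prescribed derivative at `0` in the eigenspace. -/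
theorem exists_solution_of_eigenvector {Y : E → E} (hY : ∀ᶠ w in 𝓝 0, DifferentiableAt ℂ Y w)
    (hY0 : Y 0 = 0) {c : E} (hc : fderiv ℂ Y 0 c = c)
    (hk : ∀ k : ℕ, 2 ≤ k → ∀ b, ∃ a, (k : ℂ) • a - fderiv ℂ Y 0 a = b)
    {W : Set E} (hW : W ∈ 𝓝 0) :
    ∃ ρ > 0, ∃ φ : ℂ → E, DifferentiableOn ℂ φ (ball 0 ρ) ∧ MapsTo φ (ball 0 ρ) W ∧
      φ 0 = 0 ∧ deriv φ 0 = c ∧ ∀ s ∈ ball 0 ρ, s • deriv φ s = Y (φ s) := by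
  obtain ⟨L, S, hS, hL⟩ :=
    (hasStrictFDerivAt_of_eventually_differentiableAt hY).exists_lipschitzOnWith
  obtain ⟨V, hVsub, hV, h0V⟩ := _root_.mem_nhds_iff.1 (inter_mem (inter_mem hS hW) hY)
  -- The order `M = n + 2` then exceeds both `L + 1` and `2 L`.
  obtain ⟨n, hn⟩ := exists_nat_ge (2 * L + 1 : ℝ)
  obtain ⟨p, hp, hp0, hpc, hO⟩ := exists_approximate_solution hY hY0 hc hk n
  have hLn : (0 : ℝ) ≤ L := L.2
  obtain ⟨ρ, hρ, φ, h1, h2, h3, h4, h5⟩ := exists_solution_near_approximate_solution hV h0V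
    (fun w hw => (hVsub hw).2.differentiableWithinAt) hY0
    (hL.mono fun w hw => (hVsub hw).1.1) (M := n + 2) (by omega) (by push_cast; linarith)
    (by push_cast; linarith) hp hp0 hO
  exact ⟨ρ, hρ, φ, h1, fun s hs => (hVsub (h2 hs)).1.2, h3, h4.trans hpc, h5⟩

end BriotBouquetEquation


/-! ### Linearized curves give isochronous center families. -/

/-- The disc `φ : ball 0 ρ → U` is an invariant curve of `X` on which the flow is the rotation
`s ↦ exp (i ω t) s`. -/
structure IsLinearizedCurve (U : Set Phase) (X : Phase → Phase) (ω : ℝ) (φ : ℂ → Phase)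
    (ρ : ℝ) : Prop where
  pos : 0 < ρ
  differentiableOn : DifferentiableOn ℂ φ (ball 0 ρ)
  mapsTo : MapsTo φ (ball 0 ρ) U
  map_zero : φ 0 = 0
  deriv_ne_zero : deriv φ 0 ≠ 0
  equation : ∀ s ∈ ball 0 ρ, (I * ω * s) • deriv φ s = X (φ s)

namespace IsLinearizedCurve

variable {U : Set Phase} {X : Phase → Phase} {ω : ℝ} {φ : ℂ → Phase} {ρ : ℝ}

theorem hasDerivAt (h : IsLinearizedCurve U X ω φ ρ) {s : ℂ} (hs : s ∈ ball (0 : ℂ) ρ) :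
    HasDerivAt φ (deriv φ s) s :=
  (h.differentiableOn.differentiableAt (isOpen_ball.mem_nhds hs)).hasDerivAt

/-- The disc of a linearized curve is embedded after shrinking. -/
theorem exists_embedded (h : IsLinearizedCurve U X ω φ ρ) :
    ∃ ρ' > 0, IsLinearizedCurve U X ω φ ρ' ∧ (∃ K : NNReal, ∀ s ∈ ball (0 : ℂ) ρ',
      ∀ t ∈ ball (0 : ℂ) ρ', dist s t ≤ K * dist (φ s) (φ t)) ∧
      IsEmbedding (fun s : ball (0 : ℂ) ρ' => φ s) ∧ ∀ s ∈ ball (0 : ℂ) ρ', deriv φ s ≠ 0 := by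
  have han : AnalyticAt ℂ φ 0 := h.differentiableOn.analyticAt (ball_mem_nhds 0 h.pos)
  have hs : HasStrictDerivAt φ (deriv φ 0) 0 := han.hasStrictDerivAt
  obtain ⟨L, S, hS, hL⟩ := HasStrictFDerivAt.exists_lipschitzOnWith hs.hasStrictFDerivAt
  have hc : 0 < ‖deriv φ 0‖ := norm_pos_iff.2 h.deriv_ne_zero
  -- A linearization error of at most half of `‖φ'(0)‖ ‖s - t‖` leaves the other half as a lower
  -- bound for `‖φ s - φ t‖`; hence the constant `2 / ‖φ'(0)‖`.
  have h1 := hs.hasStrictFDerivAt.isLittleO.def (half_pos hc)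
  rw [nhds_prod_eq, eventually_prod_self_iff'] at h1
  obtain ⟨S', hS', hanti⟩ := h1
  have hne : ∀ᶠ s in 𝓝 0, deriv φ s ≠ 0 := han.deriv.continuousAt.eventually_ne h.deriv_ne_zero
  obtain ⟨ρ', hρ', hsub⟩ := Metric.mem_nhds_iff.1
    (inter_mem (inter_mem (inter_mem hS hS') hne) (ball_mem_nhds 0 h.pos))
  have hbound : ∀ s ∈ ball (0 : ℂ) ρ', ∀ t ∈ ball (0 : ℂ) ρ',
      dist s t ≤ (Real.toNNReal (2 / ‖deriv φ 0‖) : NNReal) * dist (φ s) (φ t) := by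
    intro s hs t ht
    rw [Real.coe_toNNReal _ (by positivity), dist_eq_norm, dist_eq_norm]
    have h2 := hanti s (hsub hs).1.1.2 t (hsub ht).1.1.2
    simp only [ContinuousLinearMap.toSpanSingleton_apply] at h2
    have h3 : ‖(s - t) • deriv φ 0‖ ≤ ‖φ s - φ t‖ + ‖φ s - φ t - (s - t) • deriv φ 0‖ := by
      calc ‖(s - t) • deriv φ 0‖ = ‖(φ s - φ t) - (φ s - φ t - (s - t) • deriv φ 0)‖ := by
            congr 1; abel
        _ ≤ _ := norm_sub_le _ _
    rw [norm_smul] at h3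
    rw [div_mul_eq_mul_div, le_div_iff₀ hc]
    linarith
  have hanti' : AntilipschitzWith (Real.toNNReal (2 / ‖deriv φ 0‖))
      (fun s : ball (0 : ℂ) ρ' => φ s) :=
    AntilipschitzWith.of_le_mul_dist fun s t => hbound s s.2 t t.2
  have hlip : LipschitzWith L (fun s : ball (0 : ℂ) ρ' => φ s) := by
    refine LipschitzWith.of_dist_le_mul fun s t => ?_
    exact hL.dist_le_mul s (hsub s.2).1.1.1 t (hsub t.2).1.1.1
  have hle : IsLinearizedCurve U X ω φ ρ' :=
    { pos := hρ'
      differentiableOn := h.differentiableOn.mono fun s hs => (hsub hs).2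
      mapsTo := h.mapsTo.mono_left fun s hs => (hsub hs).2
      map_zero := h.map_zero
      deriv_ne_zero := h.deriv_ne_zero
      equation := fun s hs => h.equation s (hsub hs).2 }
  exact ⟨ρ', hρ', hle, ⟨_, hbound⟩, (hanti'.isUniformEmbedding hlip.uniformContinuous).isEmbedding,
    fun s hs => (hsub hs).1.2⟩

/-- The solution of `ẇ = X w` on a linearized curve. -/
theorem hasDerivAt_flow (h : IsLinearizedCurve U X ω φ ρ) {s : ℂ} (hs : s ∈ ball (0 : ℂ) ρ)
    (t : ℝ) :
    exp (I * ω * t) * s ∈ ball (0 : ℂ) ρ ∧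
      HasDerivAt (fun t : ℝ => φ (exp (I * ω * t) * s)) (X (φ (exp (I * ω * t) * s))) t := by
  have hmem : exp (I * ω * t) * s ∈ ball (0 : ℂ) ρ := by
    rw [mem_ball_zero_iff] at *
    rw [norm_mul, show I * ω * t = ((ω * t : ℝ) : ℂ) * I by push_cast; ring, norm_exp_ofReal_mul_I,
      one_mul]
    exact hs
  refine ⟨hmem, ?_⟩
  rw [← h.equation _ hmem]
  have h1 : HasDerivAt (fun t : ℝ => exp (I * ω * t) * s) (I * ω * (exp (I * ω * t) * s)) t := by
    have h2 : HasDerivAt (fun t : ℝ => I * ω * (t : ℂ)) (I * ω) t := by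
      simpa using (Complex.ofRealCLM.hasDerivAt (x := t)).const_mul (I * (ω : ℂ))
    exact (h2.cexp.mul_const s).congr_deriv (by ring)
  exact (h.hasDerivAt hmem).scomp t h1

theorem isCenterManifold (h : IsLinearizedCurve U X ω φ ρ)
    (hemb : IsEmbedding (fun s : ball (0 : ℂ) ρ => φ s))
    (hne : ∀ s ∈ ball (0 : ℂ) ρ, deriv φ s ≠ 0) {L : Submodule ℂ Phase} (hL : deriv φ 0 ∈ L) :
    IsCenterManifold U X L (φ '' ball 0 ρ) := by
  refine ⟨h.mapsTo.image_subset, ?_, ρ, h.pos, φ, h.differentiableOn, hemb, hne, rfl,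
    h.map_zero, hL⟩
  rintro _ ⟨s, hs, rfl⟩
  refine ⟨1, one_pos, fun t => φ (exp (I * ω * t) * s), by simp, fun t _ => ?_⟩
  have h1 := h.hasDerivAt_flow hs t
  exact ⟨mem_image_of_mem φ h1.1, h1.2⟩

theorem hasIsochronousFamily (h : IsLinearizedCurve U X ω φ ρ) (hω : ω ≠ 0)
    (hinj : InjOn φ (ball 0 ρ)) :
    HasIsochronousFamily X (φ '' ball 0 ρ) (2 * Real.pi / |ω|) := by
  -- Rotations preserve the disc, so no orbit leaves it and no shrinking is needed.
  refine ⟨univ, univ_mem, ?_⟩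
  rintro _ ⟨⟨s, hs, rfl⟩, -⟩ hp
  have hs0 : s ≠ 0 := by
    rintro rfl
    exact hp h.map_zero
  have hω' : 0 < |ω| := abs_pos.2 hω
  have hexp : ∀ T : ℝ, exp (I * ω * T) = 1 ↔ ∃ n : ℤ, ω * T = n * (2 * Real.pi) := by
    intro T
    rw [exp_eq_one_iff]
    refine exists_congr fun n => ⟨fun hn => ?_, fun hn => ?_⟩
    · have : ((ω * T : ℝ) : ℂ) * I = ((n * (2 * Real.pi) : ℝ) : ℂ) * I := by
        push_cast
        linear_combination hn
      exact_mod_cast mul_right_cancel₀ I_ne_zero this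
    · have : ((ω * T : ℝ) : ℂ) = ((n * (2 * Real.pi) : ℝ) : ℂ) := by rw [hn]
      push_cast at this
      linear_combination I * this
  refine ⟨fun t => φ (exp (I * ω * t) * s), by simp, fun t => ?_, by positivity, ?_, ?_⟩
  · have h1 := h.hasDerivAt_flow hs t
    exact ⟨mem_image_of_mem φ h1.1, h1.2⟩
  · intro t
    have h1 : exp (I * ω * (2 * Real.pi / |ω| : ℝ)) = 1 := by
      rw [hexp]
      rcases abs_choice ω with h2 | h2 <;> rw [h2]
      · exact ⟨1, by field_simp; simp⟩
      · exact ⟨-1, by field_simp; simp⟩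
    simp only
    rw [ofReal_add, mul_add, exp_add, h1, mul_one]
  · intro T hT hTlt hper
    have h1 := hper 0
    simp only [zero_add, ofReal_zero, mul_zero, exp_zero, one_mul] at h1
    have h2 := hinj (h.hasDerivAt_flow hs T).1 hs h1
    -- Injectivity of `φ` turns a period of the orbit into a period of the rotation, so `ω T` is a
    -- nonzero multiple of `2π`.
    have h3 : exp (I * ω * T) = 1 := mul_right_cancel₀ hs0 (h2.trans (one_mul s).symm)
    obtain ⟨n, hn⟩ := (hexp T).1 h3
    have hn0 : n ≠ 0 := by
      rintro rfl
      rw [Int.cast_zero, zero_mul] at hn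
      exact (mul_ne_zero hω hT.ne') hn
    have hn1 : (1 : ℝ) ≤ |(n : ℝ)| := by exact_mod_cast Int.one_le_abs hn0
    have h4 := congrArg abs hn
    rw [abs_mul, abs_mul, abs_of_pos hT, abs_of_pos Real.two_pi_pos] at h4
    rw [lt_div_iff₀ hω'] at hTlt
    nlinarith [Real.two_pi_pos]

theorem existsCenterFamily (h : IsLinearizedCurve U X ω φ ρ) (hω : ω ≠ 0)
    {L : Submodule ℂ Phase} (hL : deriv φ 0 ∈ L) :
    ExistsCenterFamily U X L (2 * Real.pi / |ω|) := by
  obtain ⟨ρ', hρ', h', -, hemb, hne⟩ := h.exists_embedded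
  exact ⟨φ '' ball 0 ρ', h'.isCenterManifold hemb hne hL,
    h'.hasIsochronousFamily hω (injOn_iff_injective.2 hemb.injective)⟩

end IsLinearizedCurve

/-! ### Telling germs of curves apart. -/

/-- Near the origin, the punctured curve `φ` does not run inside the curve `ψ`. -/
def GermNotLe {E : Type*} (φ ψ : ℂ → E) : Prop :=
  ¬ ∃ t : ℂ → ℂ, Tendsto t (𝓝[≠] 0) (𝓝 0) ∧ ∀ᶠ s in 𝓝[≠] 0, φ s = ψ (t s)

/-- If two images agree near `0`, each point of one has a parameter `t` on the other; the inverse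
Lipschitz bound forces `t → 0`, which `GermNotLe` forbids. No regularity of `t` is needed. -/
theorem infinitelyManyCenterFamilies_of_curves {U : Set Phase} {X : Phase → Phase} {ω : ℝ}
    (hω : ω ≠ 0) {L : Submodule ℂ Phase} {φ : ℕ → ℂ → Phase} {ρ : ℕ → ℝ}
    (h : ∀ k, IsLinearizedCurve U X ω (φ k) (ρ k)) (hL : ∀ k, deriv (φ k) 0 ∈ L)
    (hne : ∀ j k, j ≠ k → GermNotLe (φ j) (φ k)) :
    InfinitelyManyCenterFamilies U X L (2 * Real.pi / |ω|) := by
  choose r hr hc K hemb hd using fun k => (h k).exists_embedded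
  choose K hK using K
  refine ⟨fun k => φ k '' ball 0 (r k), fun k => ⟨(hc k).isCenterManifold (hemb k) (hd k) (hL k),
    (hc k).hasIsochronousFamily hω (injOn_iff_injective.2 (hemb k).injective)⟩, ?_⟩
  intro j k hjk heq
  apply hne j k hjk
  have hlim : Tendsto (φ j) (𝓝 0) (𝓝 0) := by
    have := ((hc j).hasDerivAt (mem_ball_self (hr j))).continuousAt.tendsto
    rwa [(hc j).map_zero] at this
  have hev : ∀ᶠ s in 𝓝 0, ∃ t ∈ ball (0 : ℂ) (r k), φ j s = φ k t := by
    filter_upwards [hlim.eventually heq, ball_mem_nhds 0 (hr j)] with s h1 h2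
    obtain ⟨t, ht, hts⟩ := h1.1 (mem_image_of_mem _ h2)
    exact ⟨t, ht, hts.symm⟩
  obtain ⟨t, ht⟩ := hev.choice
  refine ⟨t, ?_, (ht.mono fun s hs => hs.2).filter_mono nhdsWithin_le_nhds⟩
  refine Tendsto.mono_left ?_ nhdsWithin_le_nhds
  rw [tendsto_zero_iff_norm_tendsto_zero]
  have h3 : Tendsto (fun s => K k * ‖φ j s‖) (𝓝 0) (𝓝 0) := by
    simpa using hlim.norm.const_mul (K k : ℝ)
  refine squeeze_zero' (.of_forall fun s => norm_nonneg _) ?_ h3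
  filter_upwards [ht] with s hs
  have h4 := hK k (t s) hs.1 0 (mem_ball_self (hr k))
  rwa [(hc k).map_zero, dist_zero_right, dist_zero_right, ← hs.2] at h4

/-- Curves through the origin with different tangents have different germs. -/
theorem germNotLe_of_deriv_ne {E : Type*} [NormedAddCommGroup E] [NormedSpace ℂ E]
    {f g : ℂ → E} {a b : E} (hf : HasDerivAt f a 0) (hg : HasDerivAt g b 0) (hf0 : f 0 = 0)
    (hg0 : g 0 = 0) (ℓ : E →L[ℂ] ℂ) (ha : ℓ a = 1) (hb : ℓ b = 1) (hab : a ≠ b) :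
    GermNotLe f g := by
  rintro ⟨t, ht, heq⟩
  apply hab
  have hfo : (fun s => f s - s • a) =o[𝓝[≠] 0] fun s : ℂ => s := by
    simpa [hasDerivAt_iff_isLittleO, hf0] using
      (hasDerivAt_iff_isLittleO.1 hf).mono (nhdsWithin_le_nhds (s := {0}ᶜ))
  have hgo : (fun s => f s - t s • b) =o[𝓝[≠] 0] t := by
    have h1 : (fun s => g s - s • b) =o[𝓝 0] fun s : ℂ => s := by
      simpa [hasDerivAt_iff_isLittleO, hg0] using hg
    refine (h1.comp_tendsto ht).congr' ?_ .rfl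
    filter_upwards [heq] with s hs
    simp [hs]
  -- As `ℓ a = ℓ b = 1`, applying `ℓ` to the approximate equality of `s • a` and `t s • b` compares
  -- the parameters: `t s ~ s`. Then `a - b` must vanish.
  have h2 : (fun s => t s - s) =o[𝓝[≠] 0] fun s => ‖t s‖ + ‖s‖ := by
    have h3 : (fun s => (f s - s • a) - (f s - t s • b)) =o[𝓝[≠] 0] fun s => ‖t s‖ + ‖s‖ := by
      refine (hfo.trans_isBigO ?_).sub (hgo.trans_isBigO ?_)
      · refine IsBigO.of_bound 1 (.of_forall fun s => ?_)
        rw [one_mul, Real.norm_of_nonneg (by positivity)]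
        linarith [norm_nonneg (t s)]
      · refine IsBigO.of_bound 1 (.of_forall fun s => ?_)
        rw [one_mul, Real.norm_of_nonneg (by positivity)]
        linarith [norm_nonneg s]
    refine ((ℓ.isBigO_comp _ _).trans_isLittleO h3).congr_left fun s => ?_
    simp [ha, hb]
  have h4 : t =O[𝓝[≠] 0] fun s : ℂ => s := by
    have h5 := h2.def (show (0 : ℝ) < 1 / 2 by norm_num)
    refine IsBigO.of_bound 3 ?_
    filter_upwards [h5] with s hs
    rw [Real.norm_of_nonneg (by positivity)] at hs
    have := norm_sub_norm_le (t s) s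
    linarith
  have h6 : (fun s => t s - s) =o[𝓝[≠] 0] fun s : ℂ => s := by
    refine h2.trans_isBigO ?_
    exact h4.norm_left.add (isBigO_refl _ _).norm_left
  have h7 : (fun s : ℂ => s • (a - b)) =o[𝓝[≠] 0] fun s : ℂ => s := by
    have h8 : (fun s => (t s - s) • b) =o[𝓝[≠] 0] fun s : ℂ => s := by
      refine IsBigO.trans_isLittleO ?_ h6
      refine IsBigO.of_bound ‖b‖ (.of_forall fun s => ?_)
      rw [norm_smul, mul_comm]
    refine (((hgo.trans_isBigO h4).sub hfo).add h8).congr_left fun s => ?_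
    simp only [smul_sub, sub_smul]
    abel
  have h9 : (fun _ : ℂ => a - b) =o[𝓝[≠] 0] fun _ => (1 : ℂ) := by
    have h10 := (isBigO_refl (fun s : ℂ => s⁻¹) (𝓝[≠] 0)).smul_isLittleO h7
    refine h10.congr' ?_ ?_ <;> filter_upwards [self_mem_nhdsWithin] with s hs
    · rw [smul_smul, inv_mul_cancel₀ hs, one_smul]
    · rw [smul_eq_mul, inv_mul_cancel₀ hs]
  exact sub_eq_zero.1 ((isLittleO_const_const_iff).1 h9)


theorem GermNotLe.of_imp {E F : Type*} {f g : ℂ → E} {f' g' : ℂ → F} (h : GermNotLe f g)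
    (himp : ∀ᶠ s in 𝓝[≠] 0, ∀ t, f' s = g' t → f s = g t) : GermNotLe f' g' := by
  rintro ⟨t, ht, heq⟩
  refine h ⟨t, ht, ?_⟩
  filter_upwards [himp, heq] with s h1 h2 using h1 _ h2

/-- A parameter change `t` between the composites yields `η ∘ t ∘ χ⁻¹` between `f` and `g`. Only `χ`
has to be inverted; continuity of `η` at `0` is enough. -/
theorem GermNotLe.comp {E : Type*} {f g : ℂ → E} (h : GermNotLe f g) {χ η : ℂ → ℂ} {a : ℂ}
    (hχ : HasStrictDerivAt χ a 0) (ha : a ≠ 0) (hχ0 : χ 0 = 0) (hη : ContinuousAt η 0)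
    (hη0 : η 0 = 0) : GermNotLe (f ∘ χ) (g ∘ η) := by
  rintro ⟨t, ht, heq⟩
  set ι := hχ.localInverse χ a 0 ha with hι
  have hright : ∀ᶠ s in 𝓝 0, χ (ι s) = s := by
    simpa [hχ0] using (hχ.hasStrictFDerivAt_equiv ha).eventually_right_inverse
  have hcont : Tendsto ι (𝓝 0) (𝓝 0) := by
    have h1 := (hχ.hasStrictFDerivAt_equiv ha).localInverse_continuousAt
    have h2 := (hχ.hasStrictFDerivAt_equiv ha).localInverse_apply_image
    have h3 := h1.tendsto
    rwa [h2, hχ0] at h3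
  have hcont' : Tendsto ι (𝓝[≠] 0) (𝓝[≠] 0) := by
    refine tendsto_nhdsWithin_iff.2 ⟨hcont.mono_left nhdsWithin_le_nhds, ?_⟩
    filter_upwards [hright.filter_mono nhdsWithin_le_nhds, self_mem_nhdsWithin] with s h1 h2 h3
    rw [mem_singleton_iff] at h3
    rw [h3, hχ0] at h1
    exact h2 h1.symm
  refine h ⟨fun s => η (t (ι s)), ?_, ?_⟩
  · have h1 := hη.tendsto
    rw [hη0] at h1
    exact h1.comp (ht.comp hcont')
  · filter_upwards [hcont'.eventually heq, hright.filter_mono nhdsWithin_le_nhds] with s h1 h2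
    simpa [h2] using h1

/-! ### Diagonal Briot–Bouquet systems and their changes of unknowns. -/

/-- The derivative at the origin of a function which is linear on the plane `τ = 0`. -/
theorem fderiv_apply_of_linear_on_plane {g : ℂ × ℂ × ℂ → ℂ} (hg : DifferentiableAt ℂ g 0) {α β : ℂ}
    (h0 : ∀ u v, g (0, u, v) = α * u + β * v) (a b c : ℂ) :
    fderiv ℂ g 0 (a, b, c) = deriv (fun t => g (t, 0, 0)) 0 * a + (α * b + β * c) := by
  have key : ∀ x : ℂ × ℂ × ℂ, HasDerivAt (fun t : ℂ => g (t • x)) (fderiv ℂ g 0 x) 0 := by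
    intro x
    have h1 : HasDerivAt (fun t : ℂ => t • x) x 0 := by
      simpa using (hasDerivAt_id (0 : ℂ)).smul_const x
    refine HasFDerivAt.comp_hasDerivAt (0 : ℂ) ?_ h1
    simpa using hg.hasFDerivAt
  have h1 : fderiv ℂ g 0 (1, 0, 0) = deriv (fun t => g (t, 0, 0)) 0 := by
    simpa using (key (1, 0, 0)).deriv.symm
  have h2 : fderiv ℂ g 0 (0, b, c) = α * b + β * c := by
    have h3 := key (0, b, c)
    simp only [Prod.smul_mk, smul_eq_mul, mul_zero, h0] at h3
    have h4 : HasDerivAt (fun t : ℂ => α * (t * b) + β * (t * c)) (α * (1 * b) + β * (1 * c)) 0 :=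
      (((hasDerivAt_id (0 : ℂ)).mul_const b).const_mul α).add
        (((hasDerivAt_id (0 : ℂ)).mul_const c).const_mul β)
    simpa using h3.unique h4
  have h5 : ((a, b, c) : ℂ × ℂ × ℂ) = a • ((1 : ℂ), (0 : ℂ), (0 : ℂ)) + (0, b, c) := by simp
  rw [h5, map_add, map_smul, h1, h2, smul_eq_mul, mul_comm]

namespace BriotBouquet

/-- The system is holomorphic near the origin, and its restriction to `τ = 0` is the diagonal
linear system with coefficients `q` and `s`. -/
structure IsDiagonal (S : BriotBouquet) (q s : ℂ) : Prop where
  differentiable_P : ∀ᶠ x : ℂ × ℂ × ℂ in 𝓝 0,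
    DifferentiableAt ℂ (fun x : ℂ × ℂ × ℂ => S.P x.1 x.2.1 x.2.2) x
  differentiable_Q : ∀ᶠ x : ℂ × ℂ × ℂ in 𝓝 0,
    DifferentiableAt ℂ (fun x : ℂ × ℂ × ℂ => S.Q x.1 x.2.1 x.2.2) x
  P_zero : ∀ u v, S.P 0 u v = q * u
  Q_zero : ∀ u v, S.Q 0 u v = s * v

namespace IsDiagonal

variable {S : BriotBouquet} {q s : ℂ}

theorem q_eq (h : S.IsDiagonal q s) : S.q = q := by
  simp only [BriotBouquet.q, h.P_zero]
  simp

theorem s_eq (h : S.IsDiagonal q s) : S.s = s := by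
  simp only [BriotBouquet.s, h.Q_zero]
  simp

theorem fderiv_P (h : S.IsDiagonal q s) (a b c : ℂ) :
    fderiv ℂ (fun x : ℂ × ℂ × ℂ => S.P x.1 x.2.1 x.2.2) 0 (a, b, c) = S.p * a + q * b := by
  rw [fderiv_apply_of_linear_on_plane (α := q) (β := 0) h.differentiable_P.self_of_nhds
    (by simp [h.P_zero])]
  simp [BriotBouquet.p]

theorem fderiv_Q (h : S.IsDiagonal q s) (a b c : ℂ) :
    fderiv ℂ (fun x : ℂ × ℂ × ℂ => S.Q x.1 x.2.1 x.2.2) 0 (a, b, c) = S.r * a + s * c := by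
  rw [fderiv_apply_of_linear_on_plane (α := 0) (β := s) h.differentiable_Q.self_of_nhds
    (by simp [h.Q_zero])]
  simp [BriotBouquet.r]

end IsDiagonal

theorem eventually_differentiableAt_dslope_blowup {g : ℂ × ℂ × ℂ → ℂ}
    (hg : ∀ᶠ x in 𝓝 0, DifferentiableAt ℂ g x) (c d : ℂ) :
    ∀ᶠ x : ℂ × ℂ × ℂ in 𝓝 0, DifferentiableAt ℂ
      (fun x : ℂ × ℂ × ℂ => dslope (fun t => g (t, t * (x.2.1 + c), t * (x.2.2 + d))) 0 x.1) x := by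
  have hd : Differentiable ℂ
      fun x : ℂ × ℂ × ℂ => (x.1, x.1 * (x.2.1 + c), x.1 * (x.2.2 + d)) := by fun_prop
  refine eventually_differentiableAt_dslope (E := ℂ × ℂ) (e₀ := 0)
    (f := fun x => g (x.1, x.1 * (x.2.1 + c), x.1 * (x.2.2 + d))) ?_
  have ht : Tendsto (fun x : ℂ × ℂ × ℂ => (x.1, x.1 * (x.2.1 + c), x.1 * (x.2.2 + d)))
      (𝓝 (0, 0)) (𝓝 0) := by
    simpa using! hd.continuous.tendsto (0, 0)
  filter_upwards [ht.eventually hg] with x hx using hx.comp x (hd x)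

theorem dslope_blowup_zero {g : ℂ × ℂ × ℂ → ℂ} (hg : DifferentiableAt ℂ g 0) (a b : ℂ) :
    dslope (fun t => g (t, t * a, t * b)) 0 0 = fderiv ℂ g 0 (1, a, b) := by
  rw [dslope_same]
  refine HasDerivAt.deriv ?_
  have h1 : HasDerivAt (fun t : ℂ => (t, t * a, t * b)) (1, a, b) 0 := by
    refine (hasDerivAt_id (0 : ℂ)).prodMk (HasDerivAt.prodMk ?_ ?_)
    · simpa using (hasDerivAt_id (0 : ℂ)).mul_const a
    · simpa using (hasDerivAt_id (0 : ℂ)).mul_const b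
  refine HasFDerivAt.comp_hasDerivAt (0 : ℂ) ?_ h1
  rw [show ((0 : ℂ), 0 * a, 0 * b) = 0 by simp]
  exact hg.hasFDerivAt

/-- At `τ = 0` the new first equation is `p + q (u + c) - (u + c)`, and `c = p / (1 - q)` is the
shift that removes the constant and leaves `(q - 1) u`; likewise for the second. -/
theorem IsDiagonal.step {S : BriotBouquet} {q s : ℂ} (h : S.IsDiagonal q s) (hq : q ≠ 1)
    (hs : s ≠ 1) : S.step.IsDiagonal (q - 1) (s - 1) where
  differentiable_P := by
    filter_upwards [eventually_differentiableAt_dslope_blowup h.differentiable_P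
      (S.p / (1 - S.q)) (S.r / (1 - S.s))] with x hx
    exact hx.sub (by fun_prop)
  differentiable_Q := by
    filter_upwards [eventually_differentiableAt_dslope_blowup h.differentiable_Q
      (S.p / (1 - S.q)) (S.r / (1 - S.s))] with x hx
    exact hx.sub (by fun_prop)
  P_zero u v := by
    have h1 := dslope_blowup_zero h.differentiable_P.self_of_nhds
      (u + S.p / (1 - S.q)) (v + S.r / (1 - S.s))
    have hq' : 1 - q ≠ 0 := sub_ne_zero.2 hq.symm
    rw [h.fderiv_P] at h1
    refine (congrArg (· - _) h1).trans ?_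
    rw [h.q_eq]
    field_simp
    ring
  Q_zero u v := by
    have h1 := dslope_blowup_zero h.differentiable_Q.self_of_nhds
      (u + S.p / (1 - S.q)) (v + S.r / (1 - S.s))
    have hs' : 1 - s ≠ 0 := sub_ne_zero.2 hs.symm
    rw [h.fderiv_Q] at h1
    refine (congrArg (· - _) h1).trans ?_
    rw [h.s_eq]
    field_simp
    ring

/-- A holomorphic curve `(τ, u, v)` through the origin, transverse to `τ = 0`, which is tangent
to the system. -/
structure IsSolution (S : BriotBouquet) (ρ : ℝ) (τ u v : ℂ → ℂ) : Prop where
  pos : 0 < ρ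
  differentiable_τ : DifferentiableOn ℂ τ (ball 0 ρ)
  differentiable_u : DifferentiableOn ℂ u (ball 0 ρ)
  differentiable_v : DifferentiableOn ℂ v (ball 0 ρ)
  τ_zero : τ 0 = 0
  u_zero : u 0 = 0
  v_zero : v 0 = 0
  deriv_τ : deriv τ 0 = 1
  equation_τ : ∀ s ∈ ball 0 ρ, s * deriv τ s = τ s
  equation_u : ∀ s ∈ ball 0 ρ, s * deriv u s = S.P (τ s) (u s) (v s)
  equation_v : ∀ s ∈ ball 0 ρ, s * deriv v s = S.Q (τ s) (u s) (v s)

theorem IsSolution.eventually_ne_zero {S : BriotBouquet} {ρ : ℝ} {τ u v : ℂ → ℂ}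
    (h : S.IsSolution ρ τ u v) : ∀ᶠ s in 𝓝[≠] 0, τ s ≠ 0 := by
  have h1 := (h.differentiable_τ.differentiableAt (ball_mem_nhds 0 h.pos)).hasDerivAt
  rw [h.deriv_τ] at h1
  simpa [h.τ_zero] using h1.eventually_ne one_ne_zero (c := 0)

/-- By `s τ' = τ`, differentiating the factor `τ` restores the `u + c` subtracted in `step`, and
multiplying by `τ` undoes `dslope` since `P` and `Q` vanish at `0`. -/
theorem IsSolution.lift {S : BriotBouquet} {ρ : ℝ} {τ u v : ℂ → ℂ}
    (h : S.step.IsSolution ρ τ u v) (hP : S.P 0 0 0 = 0) (hQ : S.Q 0 0 0 = 0) :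
    S.IsSolution ρ τ (fun t => τ t * (u t + S.p / (1 - S.q)))
      (fun t => τ t * (v t + S.r / (1 - S.s))) where
  pos := h.pos
  differentiable_τ := h.differentiable_τ
  differentiable_u := h.differentiable_τ.mul (h.differentiable_u.add_const _)
  differentiable_v := h.differentiable_τ.mul (h.differentiable_v.add_const _)
  τ_zero := h.τ_zero
  u_zero := by simp [h.τ_zero]
  v_zero := by simp [h.τ_zero]
  deriv_τ := h.deriv_τ
  equation_τ := h.equation_τ
  equation_u t ht := by
    have hn := isOpen_ball.mem_nhds ht
    have h1 := (h.differentiable_τ.differentiableAt hn).hasDerivAt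
    have h2 := (h.differentiable_u.differentiableAt hn).hasDerivAt
    rw [(h1.fun_mul (h2.add_const (S.p / (1 - S.q)))).deriv]
    have h3 := sub_smul_dslope
      (fun z => S.P z (z * (u t + S.p / (1 - S.q))) (z * (v t + S.r / (1 - S.s)))) 0 (τ t)
    simp only [zero_mul, hP, sub_zero, smul_eq_mul] at h3
    have h4 := h.equation_u t ht
    simp only [BriotBouquet.step] at h4
    linear_combination (u t + S.p / (1 - S.q)) * h.equation_τ t ht + τ t * h4 + h3
  equation_v t ht := by
    have hn := isOpen_ball.mem_nhds ht
    have h1 := (h.differentiable_τ.differentiableAt hn).hasDerivAt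
    have h2 := (h.differentiable_v.differentiableAt hn).hasDerivAt
    rw [(h1.fun_mul (h2.add_const (S.r / (1 - S.s)))).deriv]
    have h3 := sub_smul_dslope
      (fun z => S.Q z (z * (u t + S.p / (1 - S.q))) (z * (v t + S.r / (1 - S.s)))) 0 (τ t)
    simp only [zero_mul, hQ, sub_zero, smul_eq_mul] at h3
    have h4 := h.equation_v t ht
    simp only [BriotBouquet.step] at h4
    linear_combination (v t + S.r / (1 - S.s)) * h.equation_τ t ht + τ t * h4 + h3

/-- If `s = 1` and `r = 0`, the slope of `v` at the origin is a free parameter. -/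
theorem IsDiagonal.exists_solution_of_resonance {S : BriotBouquet} {k : ℕ}
    (h : S.IsDiagonal (-k) 1) (hr : S.r = 0) (β : ℂ) :
    ∃ ρ τ u v, S.IsSolution ρ τ u v ∧ HasDerivAt (fun t => (τ t, u t, v t))
      ((1 : ℂ), S.p / (1 + k), β) 0 := by
  -- Taking `τ` as a third unknown makes the system autonomous. Its derivative has eigenvalues `1`,
  -- `-k`, `1`, and since `r = 0` every `(1, p / (1 + k), β)` is an eigenvector for `1`.
  let Y : ℂ × ℂ × ℂ → ℂ × ℂ × ℂ :=
    fun x => (x.1, S.P x.1 x.2.1 x.2.2, S.Q x.1 x.2.1 x.2.2)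
  have hY : ∀ᶠ x in 𝓝 0, DifferentiableAt ℂ Y x := by
    filter_upwards [h.differentiable_P, h.differentiable_Q] with x h1 h2
    exact differentiableAt_fst.prodMk (h1.prodMk h2)
  have hfd : ∀ a b c : ℂ, fderiv ℂ Y 0 (a, b, c) = (a, S.p * a - k * b, c) := by
    intro a b c
    have h1 := (hasFDerivAt_fst (𝕜 := ℂ) (p := (0 : ℂ × ℂ × ℂ))).prodMk
      (h.differentiable_P.self_of_nhds.hasFDerivAt.prodMk
        h.differentiable_Q.self_of_nhds.hasFDerivAt)
    rw [show fderiv ℂ Y 0 = _ from h1.fderiv]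
    simp only [ContinuousLinearMap.prod_apply, h.fderiv_P, h.fderiv_Q, hr]
    simp only [ContinuousLinearMap.coe_fst', Prod.mk.injEq, true_and]
    constructor <;> ring
  have hk1 : (1 + k : ℂ) ≠ 0 := by exact_mod_cast Nat.succ_ne_zero k ∘ (by omega)
  obtain ⟨ρ, hρ, φ, hφ, -, hφ0, hφc, heq⟩ := exists_solution_of_eigenvector hY
    (c := ((1 : ℂ), S.p / (1 + k), β)) (by simp [Y, h.P_zero, h.Q_zero])
    (by
      rw [hfd]
      simp only [Prod.mk.injEq, true_and, and_true]
      field_simp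
      ring)
    (by
      rintro m hm ⟨b₁, b₂, b₃⟩
      have h1 : (m - 1 : ℂ) ≠ 0 := sub_ne_zero.2 (by exact_mod_cast (by omega : m ≠ 1))
      have h2 : (m + k : ℂ) ≠ 0 := by exact_mod_cast (by omega : m + k ≠ 0)
      -- Forward substitution in a triangular system with diagonal `m - 1`, `m + k`, `m - 1`.
      refine ⟨(b₁ / (m - 1), (b₂ + S.p * (b₁ / (m - 1))) / (m + k), b₃ / (m - 1)), ?_⟩
      rw [hfd]
      simp only [Prod.smul_mk, Prod.mk_sub_mk, smul_eq_mul, Prod.mk.injEq]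
      refine ⟨by field_simp, ?_, by field_simp⟩
      field_simp
      ring) univ_mem
  have hder : ∀ t ∈ ball (0 : ℂ) ρ, HasDerivAt φ (deriv φ t) t := fun t ht =>
    (hφ.differentiableAt (isOpen_ball.mem_nhds ht)).hasDerivAt
  have hd1 : ∀ t ∈ ball (0 : ℂ) ρ, HasDerivAt (fun t => (φ t).1) (deriv φ t).1 t :=
    fun t ht => (ContinuousLinearMap.fst ℂ ℂ (ℂ × ℂ)).hasFDerivAt.comp_hasDerivAt t (hder t ht)
  have hd' : ∀ t ∈ ball (0 : ℂ) ρ, HasDerivAt (fun t => (φ t).2) (deriv φ t).2 t :=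
    fun t ht => (ContinuousLinearMap.snd ℂ ℂ (ℂ × ℂ)).hasFDerivAt.comp_hasDerivAt t (hder t ht)
  have hd2 : ∀ t ∈ ball (0 : ℂ) ρ, HasDerivAt (fun t => (φ t).2.1) (deriv φ t).2.1 t :=
    fun t ht => (ContinuousLinearMap.fst ℂ ℂ ℂ).hasFDerivAt.comp_hasDerivAt t (hd' t ht)
  have hd3 : ∀ t ∈ ball (0 : ℂ) ρ, HasDerivAt (fun t => (φ t).2.2) (deriv φ t).2.2 t :=
    fun t ht => (ContinuousLinearMap.snd ℂ ℂ ℂ).hasFDerivAt.comp_hasDerivAt t (hd' t ht)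
  refine ⟨ρ, fun t => (φ t).1, fun t => (φ t).2.1, fun t => (φ t).2.2, ?_, ?_⟩
  · exact
      { pos := hρ
        differentiable_τ := fun t ht => (hd1 t ht).differentiableAt.differentiableWithinAt
        differentiable_u := fun t ht => (hd2 t ht).differentiableAt.differentiableWithinAt
        differentiable_v := fun t ht => (hd3 t ht).differentiableAt.differentiableWithinAt
        τ_zero := by simp [hφ0]
        u_zero := by simp [hφ0]
        v_zero := by simp [hφ0]
        deriv_τ := by rw [(hd1 0 (mem_ball_self hρ)).deriv, hφc]
        equation_τ := fun t ht => by
          rw [(hd1 t ht).deriv]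
          exact congrArg Prod.fst (heq t ht)
        equation_u := fun t ht => by
          rw [(hd2 t ht).deriv]
          exact congrArg (fun x => x.2.1) (heq t ht)
        equation_v := fun t ht => by
          rw [(hd3 t ht).deriv]
          exact congrArg (fun x => x.2.2) (heq t ht) }
  · have := hder 0 (mem_ball_self hρ)
    rwa [hφc] at this

/-- A system which becomes resonant after `m` steps, with vanishing obstruction `r`, has infinitely
many solutions. -/
theorem IsDiagonal.exists_solutions {S : BriotBouquet} {k m : ℕ} (h : S.IsDiagonal (-k) (m + 1))
    (hr : (BriotBouquet.step^[m] S).r = 0) :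
    ∃ (ρ : ℕ → ℝ) (τ u v : ℕ → ℂ → ℂ), (∀ j, S.IsSolution (ρ j) (τ j) (u j) (v j)) ∧
      ∀ i j, i ≠ j → GermNotLe (fun t => (τ i t, u i t, v i t)) (fun t => (τ j t, u j t, v j t)) := by
  induction m generalizing S k with
  | zero =>
    choose ρ τ u v hsol hder using fun j : ℕ =>
      IsDiagonal.exists_solution_of_resonance (by simpa using h) hr (j : ℂ)
    refine ⟨ρ, τ, u, v, hsol, fun i j hij => ?_⟩
    refine germNotLe_of_deriv_ne (hder i) (hder j)
      (by simp [(hsol i).τ_zero, (hsol i).u_zero, (hsol i).v_zero])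
      (by simp [(hsol j).τ_zero, (hsol j).u_zero, (hsol j).v_zero])
      (ContinuousLinearMap.fst ℂ ℂ (ℂ × ℂ)) rfl rfl ?_
    simpa using hij
  | succ m ih =>
    -- The coefficients before the step are `-k` and `m + 2`; neither equals `1`, so the shifts are
    -- defined.
    have hstep : S.step.IsDiagonal (-(k + 1 : ℕ)) (m + 1) := by
      have h1 := h.step (by
        intro h2
        have h3 : ((1 + k : ℕ) : ℂ) = 0 := by push_cast; linear_combination -h2
        exact absurd (Nat.cast_eq_zero.1 h3) (by omega))
        (by
          rw [ne_eq, add_eq_right]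
          exact_mod_cast Nat.succ_ne_zero m)
      convert h1 using 1 <;> push_cast <;> ring
    obtain ⟨ρ, τ, u, v, hsol, hne⟩ := ih hstep (by simpa using hr)
    refine ⟨ρ, τ, _, _, fun j => (hsol j).lift (by simp [h.P_zero]) (by simp [h.Q_zero]), ?_⟩
    intro i j hij
    refine (hne i j hij).of_imp ?_
    -- The substitution is injective where `τ ≠ 0`, hence on the punctured curve.
    filter_upwards [(hsol i).eventually_ne_zero] with t ht t' heq
    simp only [Prod.mk.injEq] at heq ⊢
    obtain ⟨h1, h2, h3⟩ := heq
    rw [← h1] at h2 h3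
    exact ⟨h1, add_right_cancel (mul_left_cancel₀ ht h2), add_right_cancel (mul_left_cancel₀ ht h3)⟩

end BriotBouquet


/-! ### From the blown-up system back to the vector field. -/

/-- The blow-up of the `y`-axis. -/
noncomputable def blowupY (τ u v : ℂ) : Phase := ![τ * u, τ, τ * v]

theorem blowupY_zero (u v : ℂ) : blowupY 0 u v = 0 := by
  ext i
  fin_cases i <;> simp [blowupY]

theorem differentiable_blowupY :
    Differentiable ℂ fun x : ℂ × ℂ × ℂ => blowupY x.1 x.2.1 x.2.2 := by
  rw [differentiable_pi]
  intro i
  fin_cases i <;> simp [blowupY] <;> fun_prop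

theorem hasDerivAt_vec {f g h : ℂ → ℂ} {a b c t : ℂ} (hf : HasDerivAt f a t)
    (hg : HasDerivAt g b t) (hh : HasDerivAt h c t) :
    HasDerivAt (fun t => (![f t, g t, h t] : Phase)) ![a, b, c] t := by
  rw [hasDerivAt_pi]
  intro i
  fin_cases i <;> simpa

section

variable {X : Phase → Phase} {l μ : ℂ}

theorem eventually_differentiableAt_dslope_blowupY (hX : ∀ᶠ w in 𝓝 0, DifferentiableAt ℂ X w)
    (i : Fin 3) :
    ∀ᶠ x : ℂ × ℂ × ℂ in 𝓝 0, DifferentiableAt ℂ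
      (fun x : ℂ × ℂ × ℂ => dslope (fun t => X (blowupY t x.2.1 x.2.2) i) 0 x.1) x := by
  refine eventually_differentiableAt_dslope (E := ℂ × ℂ) (e₀ := 0)
    (f := fun x => X (blowupY x.1 x.2.1 x.2.2) i) ?_
  have ht : Tendsto (fun x : ℂ × ℂ × ℂ => blowupY x.1 x.2.1 x.2.2) (𝓝 (0, 0)) (𝓝 0) := by
    have h1 := differentiable_blowupY.continuous.tendsto (0, 0)
    rwa [blowupY_zero] at h1
  filter_upwards [ht.eventually hX] with x hx
  exact differentiableAt_pi.1 (hx.comp x (differentiable_blowupY x)) i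

theorem dslope_blowupY_zero (hX : DifferentiableAt ℂ X 0) (u v : ℂ) (i : Fin 3) :
    dslope (fun t => X (blowupY t u v) i) 0 0 = fderiv ℂ X 0 ![u, 1, v] i := by
  rw [dslope_same]
  refine HasDerivAt.deriv ?_
  have h1 : HasDerivAt (fun t : ℂ => blowupY t u v) ![u, 1, v] 0 := by
    refine hasDerivAt_vec ?_ (hasDerivAt_id (0 : ℂ)) ?_
    · simpa using (hasDerivAt_id (0 : ℂ)).mul_const u
    · simpa using (hasDerivAt_id (0 : ℂ)).mul_const v
  have h2 : HasFDerivAt X (fderiv ℂ X 0) (blowupY 0 u v) := by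
    rw [blowupY_zero]
    exact hX.hasFDerivAt
  exact hasDerivAt_pi.1 (h2.comp_hasDerivAt (0 : ℂ) h1) i

/-- On `y = 0` the divided components of `X` are those of its linear part at `(u, 1, v)`, so the
right-hand sides are `l u / l - u` and `μ v / l - v`. -/
theorem alongY_isDiagonal (hX : ∀ᶠ w in 𝓝 0, DifferentiableAt ℂ X w) (hl : l ≠ 0)
    (hA : ∀ a b c, fderiv ℂ X 0 ![a, b, c] = ![l * a, l * b, μ * c]) :
    (alongY X).IsDiagonal 0 (μ / l - 1) := by
  have h0 : ∀ u v : ℂ, dslope (fun t => X (blowupY t u v) 1) 0 0 = l := fun u v => by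
    rw [dslope_blowupY_zero hX.self_of_nhds, hA]
    simp
  have hd := eventually_differentiableAt_dslope_blowupY hX
  have hne : ∀ᶠ x : ℂ × ℂ × ℂ in 𝓝 0, dslope (fun t => X (blowupY t x.2.1 x.2.2) 1) 0 x.1 ≠ 0 := by
    refine (hd 1).self_of_nhds.continuousAt.eventually_ne ?_
    exact (h0 0 0).trans_ne hl
  refine ⟨?_, ?_, fun u v => ?_, fun u v => ?_⟩
  · filter_upwards [hd 0, hd 1, hne] with x h1 h2 h3
    exact (h1.fun_mul (h2.fun_inv h3)).sub differentiableAt_snd.fst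
  · filter_upwards [hd 2, hd 1, hne] with x h1 h2 h3
    exact (h1.fun_mul (h2.fun_inv h3)).sub differentiableAt_snd.snd
  · change dslope (fun t => X (blowupY t u v) 0) 0 0 / dslope (fun t => X (blowupY t u v) 1) 0 0 - u
      = 0 * u
    rw [h0, dslope_blowupY_zero hX.self_of_nhds, hA]
    simp [hl]
  · change dslope (fun t => X (blowupY t u v) 2) 0 0 / dslope (fun t => X (blowupY t u v) 1) 0 0 - v
      = (μ / l - 1) * v
    rw [h0, dslope_blowupY_zero hX.self_of_nhds, hA]
    simp only [Matrix.cons_val]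
    ring

/-- A solution of the blown-up system gives an invariant curve of `X`; its parametrization is
changed by `ψ` to make the motion along it linear. -/
theorem exists_linearizedCurve_of_solution {U : Set Phase} (hU : U ∈ 𝓝 0) {ω : ℝ} (hω : ω ≠ 0)
    (hX : ∀ᶠ w in 𝓝 0, DifferentiableAt ℂ X w) (hX0 : X 0 = 0)
    (hA : ∀ a b c, fderiv ℂ X 0 ![a, b, c] = ![I * ω * a, I * ω * b, μ * c])
    {ρ : ℝ} {τ u v : ℂ → ℂ} (hsol : (alongY X).IsSolution ρ τ u v) :
    ∃ (ρ' : ℝ) (ψ : ℂ → ℂ), HasStrictDerivAt ψ 1 0 ∧ ψ 0 = 0 ∧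
      IsLinearizedCurve U X ω ((fun s => blowupY (τ s) (u s) (v s)) ∘ ψ) ρ' ∧
      deriv ((fun s => blowupY (τ s) (u s) (v s)) ∘ ψ) 0 = ![0, 1, 0] := by
  have hl : I * (ω : ℂ) ≠ 0 := mul_ne_zero I_ne_zero (ofReal_ne_zero.2 hω)
  set w : ℂ → Phase := fun s => blowupY (τ s) (u s) (v s) with hw
  have hτ : ∀ s ∈ ball (0 : ℂ) ρ, HasDerivAt τ (deriv τ s) s := fun s hs =>
    (hsol.differentiable_τ.differentiableAt (isOpen_ball.mem_nhds hs)).hasDerivAt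
  have hu : ∀ s ∈ ball (0 : ℂ) ρ, HasDerivAt u (deriv u s) s := fun s hs =>
    (hsol.differentiable_u.differentiableAt (isOpen_ball.mem_nhds hs)).hasDerivAt
  have hv : ∀ s ∈ ball (0 : ℂ) ρ, HasDerivAt v (deriv v s) s := fun s hs =>
    (hsol.differentiable_v.differentiableAt (isOpen_ball.mem_nhds hs)).hasDerivAt
  have h0ρ : (0 : ℂ) ∈ ball (0 : ℂ) ρ := mem_ball_self hsol.pos
  set w' : ℂ → Phase := fun s =>
    ![deriv τ s * u s + τ s * deriv u s, deriv τ s, deriv τ s * v s + τ s * deriv v s] with hw'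
  have hwd : ∀ s ∈ ball (0 : ℂ) ρ, HasDerivAt w (w' s) s := fun s hs =>
    hasDerivAt_vec ((hτ s hs).mul (hu s hs)) (hτ s hs) ((hτ s hs).mul (hv s hs))
  have hw0 : w 0 = 0 := by
    ext i
    fin_cases i <;> simp [hw, blowupY, hsol.τ_zero]
  -- the factor by which the parametrization of `w` fails to be linear
  let D : Fin 3 → ℂ → ℂ := fun i s => dslope (fun t => X (blowupY t (u s) (v s)) i) 0 (τ s)
  have hD : ∀ i s, τ s * D i s = X (w s) i := by
    intro i s
    have h1 := sub_smul_dslope (fun t => X (blowupY t (u s) (v s)) i) 0 (τ s)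
    simpa [blowupY_zero, hX0] using h1
  have hD0 : D 1 0 = I * ω := by
    simp only [D, hsol.τ_zero]
    rw [dslope_blowupY_zero hX.self_of_nhds, hA]
    simp
  have hDd : ∀ᶠ s in 𝓝 0, DifferentiableAt ℂ (D 1) s := by
    have h1 := (hτ 0 h0ρ).continuousAt.tendsto.prodMk_nhds
      ((hu 0 h0ρ).continuousAt.tendsto.prodMk_nhds (hv 0 h0ρ).continuousAt.tendsto)
    rw [hsol.τ_zero, hsol.u_zero, hsol.v_zero] at h1
    filter_upwards [h1.eventually (eventually_differentiableAt_dslope_blowupY hX 1),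
      ball_mem_nhds 0 hsol.pos] with s h2 h3
    exact h2.comp s (f := fun s => (τ s, u s, v s)) ((hτ s h3).differentiableAt.prodMk
      ((hu s h3).differentiableAt.prodMk (hv s h3).differentiableAt))
  have hDne : ∀ᶠ s in 𝓝 0, D 1 s ≠ 0 := by
    refine hDd.self_of_nhds.continuousAt.eventually_ne ?_
    rwa [hD0]
  -- The curve `w` is tangent to `X`, with speed factor `D 1 s` in place of the constant `I ω`.
  have hflow : ∀ s ∈ ball (0 : ℂ) ρ, D 1 s ≠ 0 → (s * D 1 s) • w' s = X (w s) := by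
    intro s hs hne
    have h1 := hsol.equation_τ s hs
    have h2 : s * deriv u s = D 0 s / D 1 s - u s := hsol.equation_u s hs
    have h3 : s * deriv v s = D 2 s / D 1 s - v s := hsol.equation_v s hs
    ext i
    rw [← hD]
    fin_cases i
    · simp only [hw', Pi.smul_apply, smul_eq_mul]
      have h4 : D 1 s * (s * deriv u s) = D 0 s - D 1 s * u s := by
        rw [h2]
        field_simp
      simp
      linear_combination D 1 s * u s * h1 + τ s * h4
    · simp [hw']
      linear_combination D 1 s * h1
    · have h4 : D 1 s * (s * deriv v s) = D 2 s - D 1 s * v s := by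
        rw [h3]
        field_simp
      simp [hw']
      linear_combination D 1 s * v s * h1 + τ s * h4
  -- linearization of the one-dimensional equation
  let Y : ℂ → ℂ := fun s => s * D 1 s / (I * ω)
  have hYd : ∀ᶠ s in 𝓝 0, DifferentiableAt ℂ Y s := by
    filter_upwards [hDd] with s hs
    exact (differentiableAt_id.mul hs).div_const _
  -- As `D 1 0 = I ω`, the only eigenvalue is `1`, so `s ψ' = Y(ψ)` is solvable with `ψ'(0) = 1`,
  -- and `w ∘ ψ` moves by the rotation.
  have hY1 : fderiv ℂ Y 0 = ContinuousLinearMap.id ℂ ℂ := by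
    have h1 := ((hasDerivAt_id (0 : ℂ)).mul hDd.self_of_nhds.hasDerivAt).div_const (I * (ω : ℂ))
    ext
    simp only [id, one_mul, zero_mul, add_zero, hD0, div_self hl] at h1
    rw [show fderiv ℂ Y 0 = _ from h1.hasFDerivAt.fderiv]
    simp
  have hcont : Tendsto w (𝓝 0) (𝓝 0) := by
    have h1 := (hwd 0 h0ρ).continuousAt.tendsto
    rwa [hw0] at h1
  obtain ⟨ρ', hρ', ψ, hψd, hψm, hψ0, hψ1, hψ⟩ := exists_solution_of_eigenvector hYd (c := 1)
    (by simp [Y]) (by simp [hY1])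
    (by
      intro k hk b
      have h1 : (k - 1 : ℂ) ≠ 0 := sub_ne_zero.2 (by exact_mod_cast (by omega : k ≠ 1))
      refine ⟨b / (k - 1), ?_⟩
      rw [hY1]
      simp only [ContinuousLinearMap.id_apply, smul_eq_mul]
      field_simp)
    (inter_mem (inter_mem (ball_mem_nhds 0 hsol.pos) hDne) (hcont hU))
  have hψder : ∀ s ∈ ball (0 : ℂ) ρ', HasDerivAt ψ (deriv ψ s) s := fun s hs =>
    (hψd.differentiableAt (isOpen_ball.mem_nhds hs)).hasDerivAt
  have hcomp : ∀ s ∈ ball (0 : ℂ) ρ', HasDerivAt (w ∘ ψ) (deriv ψ s • w' (ψ s)) s := fun s hs =>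
    (hwd _ (hψm hs).1.1).scomp s (hψder s hs)
  have hder0 : deriv (w ∘ ψ) 0 = ![0, 1, 0] := by
    rw [(hcomp 0 (mem_ball_self hρ')).deriv, hψ1, hψ0, one_smul]
    simp [hw', hsol.τ_zero, hsol.u_zero, hsol.v_zero, hsol.deriv_τ]
  refine ⟨ρ', ψ, ?_, hψ0, ?_, hder0⟩
  · have h1 := (hψd.analyticAt (ball_mem_nhds 0 hρ')).hasStrictDerivAt
    rwa [hψ1] at h1
  · exact
      { pos := hρ'
        differentiableOn := fun s hs => (hcomp s hs).differentiableAt.differentiableWithinAt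
        mapsTo := fun s hs => (hψm hs).2
        map_zero := by simp [hψ0, hw0]
        deriv_ne_zero := by
          rw [hder0]
          intro h
          simpa using congrFun h 1
        equation := fun s hs => by
          have h1 : s * deriv ψ s = ψ s * D 1 (ψ s) / (I * ω) := hψ s hs
          rw [(hcomp s hs).deriv, Function.comp_apply, ← hflow _ (hψm hs).1.1 (hψm hs).1.2,
            smul_smul, mul_assoc, h1]
          congr 1
          exact mul_div_cancel₀ _ hl }

/-- If the obstruction along the `y`-axis vanishes, there are infinitely many linearized curves
tangent to it. -/
theorem exists_linearizedCurves_of_rBar_eq_zero {U : Set Phase} (hU : U ∈ 𝓝 0) {ω : ℝ} (hω : ω ≠ 0)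
    (hX : ∀ᶠ w in 𝓝 0, DifferentiableAt ℂ X w) (hX0 : X 0 = 0) {n : ℕ} (hn : 2 ≤ n)
    (hA : ∀ a b c, fderiv ℂ X 0 ![a, b, c] = ![I * ω * a, I * ω * b, I * (n * ω) * c])
    (hr : rBar X n = 0) :
    ∃ (ρ : ℕ → ℝ) (φ : ℕ → ℂ → Phase), (∀ j, IsLinearizedCurve U X ω (φ j) (ρ j)) ∧
      (∀ j, deriv (φ j) 0 = ![0, 1, 0]) ∧ ∀ i j, i ≠ j → GermNotLe (φ i) (φ j) := by
  have hl : I * (ω : ℂ) ≠ 0 := mul_ne_zero I_ne_zero (ofReal_ne_zero.2 hω)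
  have hω' : (ω : ℂ) ≠ 0 := ofReal_ne_zero.2 hω
  -- The second coefficient is `n ω / ω - 1 = (n - 2) + 1`, so exactly `n - 2` steps reach the
  -- resonance.
  have hdiag : (alongY X).IsDiagonal (-(0 : ℕ)) ((n - 2 : ℕ) + 1) := by
    convert alongY_isDiagonal hX hl hA using 1
    · simp
    · rw [Nat.cast_sub hn]
      field_simp
      push_cast
      ring
  obtain ⟨r, τ, u, v, hsol, hne⟩ := hdiag.exists_solutions hr
  choose ρ ψ hψ hψ0 hcurve hder using fun j =>
    exists_linearizedCurve_of_solution hU hω hX hX0 hA (hsol j)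
  refine ⟨ρ, _, hcurve, hder, fun i j hij => ?_⟩
  refine GermNotLe.comp ?_ (hψ i) one_ne_zero (hψ0 i) (hψ j).hasDerivAt.continuousAt (hψ0 j)
  refine (hne i j hij).of_imp ?_
  filter_upwards [(hsol i).eventually_ne_zero] with s hs t heq
  have h1 : τ i s = τ j t := congrFun heq 1
  have h2 : τ i s * u i s = τ j t * u j t := congrFun heq 0
  have h3 : τ i s * v i s = τ j t * v j t := congrFun heq 2
  rw [← h1] at h2 h3
  rw [h1, mul_left_cancel₀ hs h2, mul_left_cancel₀ hs h3]

end

/-! ### The `x`-axis by symmetry. -/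

/-- The exchange of `x` and `y`. -/
noncomputable def swapXY : Phase ≃L[ℂ] Phase :=
  ContinuousLinearEquiv.piCongrLeft ℂ (fun _ : Fin 3 => ℂ) (Equiv.swap 0 1)

theorem swapXY_apply (w : Phase) : swapXY w = ![w 1, w 0, w 2] := by
  ext i
  fin_cases i
  · exact Equiv.piCongrLeft_apply_apply (fun _ : Fin 3 => ℂ) (Equiv.swap 0 1) w 1
  · exact Equiv.piCongrLeft_apply_apply (fun _ : Fin 3 => ℂ) (Equiv.swap 0 1) w 0
  · exact Equiv.piCongrLeft_apply_apply (fun _ : Fin 3 => ℂ) (Equiv.swap 0 1) w 2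

theorem swapXY_swapXY (w : Phase) : swapXY (swapXY w) = w := by
  rw [swapXY_apply, swapXY_apply]
  ext i
  fin_cases i <;> rfl

theorem alongY_swapXY (X : Phase → Phase) :
    alongY (fun w => swapXY (X (swapXY w))) = alongX X := by
  simp [alongY, alongX, swapXY_apply]

theorem rBar_swapXY (X : Phase → Phase) (n : ℕ) :
    rBar (fun w => swapXY (X (swapXY w))) n = rHat X n := by
  rw [rBar, rHat, alongY_swapXY]

theorem IsLinearizedCurve.swapXY {U : Set Phase} {X : Phase → Phase} {ω : ℝ} {φ : ℂ → Phase} {ρ : ℝ}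
    (h : IsLinearizedCurve (swapXY ⁻¹' U) (fun w => swapXY (X (swapXY w))) ω φ ρ) :
    IsLinearizedCurve U X ω (fun s => CenterFamily.swapXY (φ s)) ρ ∧
      deriv (fun s => CenterFamily.swapXY (φ s)) 0 = CenterFamily.swapXY (deriv φ 0) := by
  have hd : ∀ s ∈ ball (0 : ℂ) ρ, HasDerivAt (fun s => CenterFamily.swapXY (φ s))
      (CenterFamily.swapXY (deriv φ s)) s := fun s hs =>
    CenterFamily.swapXY.hasFDerivAt.comp_hasDerivAt s (h.hasDerivAt hs)
  have hd0 := (hd 0 (mem_ball_self h.pos)).deriv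
  refine ⟨?_, hd0⟩
  exact
    { pos := h.pos
      differentiableOn := fun s hs => (hd s hs).differentiableAt.differentiableWithinAt
      mapsTo := h.mapsTo
      map_zero := by simp [h.map_zero]
      deriv_ne_zero := by
        rw [hd0]
        simpa using h.deriv_ne_zero
      equation := fun s hs => by
        rw [(hd s hs).deriv, ← map_smul, h.equation s hs, swapXY_swapXY] }

theorem exists_linearizedCurves_of_rHat_eq_zero {X : Phase → Phase} {U : Set Phase} (hU : U ∈ 𝓝 0)
    {ω : ℝ} (hω : ω ≠ 0)
    (hX : ∀ᶠ w in 𝓝 0, DifferentiableAt ℂ X w) (hX0 : X 0 = 0) {n : ℕ} (hn : 2 ≤ n)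
    (hA : ∀ a b c, fderiv ℂ X 0 ![a, b, c] = ![I * ω * a, I * ω * b, I * (n * ω) * c])
    (hr : rHat X n = 0) :
    ∃ (ρ : ℕ → ℝ) (φ : ℕ → ℂ → Phase), (∀ j, IsLinearizedCurve U X ω (φ j) (ρ j)) ∧
      (∀ j, deriv (φ j) 0 = ![1, 0, 0]) ∧ ∀ i j, i ≠ j → GermNotLe (φ i) (φ j) := by
  have hcont : Tendsto swapXY (𝓝 0) (𝓝 0) := by
    simpa using swapXY.continuous.tendsto 0
  have hX' : HasFDerivAt X (fderiv ℂ X 0) (swapXY 0) := by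
    rw [map_zero]
    exact hX.self_of_nhds.hasFDerivAt
  have hfd := swapXY.hasFDerivAt.comp (0 : Phase) (hX'.comp (0 : Phase) swapXY.hasFDerivAt)
  obtain ⟨ρ, φ, hφ, hder, hne⟩ := exists_linearizedCurves_of_rBar_eq_zero
    (X := fun w => swapXY (X (swapXY w))) (hcont hU) hω
    (by
      filter_upwards [hcont.eventually hX] with w hw
      exact swapXY.differentiableAt.comp w (hw.comp w swapXY.differentiableAt))
    (by simp [hX0]) hn
    (by
      intro a b c
      rw [show fderiv ℂ (fun w => swapXY (X (swapXY w))) 0 = _ from hfd.fderiv]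
      simp [swapXY_apply, hA])
    ((rBar_swapXY X n).trans hr)
  refine ⟨ρ, fun j s => swapXY (φ j s), fun j => (hφ j).swapXY.1, fun j => ?_, fun i j hij => ?_⟩
  · rw [(hφ j).swapXY.2, hder, swapXY_apply]
    rfl
  · refine (hne i j hij).of_imp (.of_forall fun s t h => swapXY.injective h)


/-! ### Nonresonant eigenvalues and the diagonal form of the derivative. -/

/-- If the eigenvalue `λ` of the derivative has no multiple `2 λ, 3 λ, …` in the spectrum, every
eigenvector is tangent to a linearized curve. The derivative is given in diagonal form. -/
theorem exists_linearizedCurve_of_nonresonant {U : Set Phase} (hU : U ∈ 𝓝 0) {X : Phase → Phase}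
    (hX : ∀ᶠ w in 𝓝 0, DifferentiableAt ℂ X w) (hX0 : X 0 = 0) {ω : ℝ} (hω : ω ≠ 0)
    {d : Fin 3 → ℝ} (hA : ∀ w i, fderiv ℂ X 0 w i = I * d i * w i)
    (hres : ∀ k : ℕ, 2 ≤ k → ∀ i, k * ω ≠ d i) {c : Phase} (hc : c ≠ 0)
    (hdc : ∀ i, d i * c i = ω * c i) :
    ∃ ρ φ, IsLinearizedCurve U X ω φ ρ ∧ deriv φ 0 = c := by
  have hl : I * (ω : ℂ) ≠ 0 := mul_ne_zero I_ne_zero (ofReal_ne_zero.2 hω)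
  let Y : Phase → Phase := fun w => (I * (ω : ℂ))⁻¹ • X w
  have hfd : ∀ w i, fderiv ℂ Y 0 w i = (I * (ω : ℂ))⁻¹ * (I * d i * w i) := by
    intro w i
    rw [show fderiv ℂ Y 0 = _ from fderiv_fun_const_smul hX.self_of_nhds _]
    simp [hA]
  obtain ⟨ρ, hρ, φ, h1, h2, h3, h4, h5⟩ := exists_solution_of_eigenvector (Y := Y) (c := c)
    (hX.mono fun w hw => hw.fun_const_smul _) (by simp [Y, hX0])
    (by
      ext i
      rw [hfd, mul_assoc, hdc, ← mul_assoc I, inv_mul_cancel_left₀ hl])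
    (by
      intro k hk b
      refine ⟨fun i => (I * ω) * b i / (I * (k * ω - d i)), ?_⟩
      ext i
      have h1 : (k * ω - d i : ℂ) ≠ 0 := sub_ne_zero.2 (by exact_mod_cast hres k hk i)
      have hω' : (ω : ℂ) ≠ 0 := ofReal_ne_zero.2 hω
      rw [Pi.sub_apply, hfd, Pi.smul_apply, smul_eq_mul]
      field_simp)
    hU
  exact ⟨ρ, φ,
    { pos := hρ
      differentiableOn := h1
      mapsTo := h2
      map_zero := h3
      deriv_ne_zero := by rwa [h4]
      equation := fun s hs => by
        rw [mul_smul, h5 s hs, smul_inv_smul₀ hl] }, h4⟩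

/-- The shape of the derivative under the assumptions on its eigenspaces. -/
theorem apply_eq_of_eigenspaces {A : Phase →L[ℂ] Phase} {ω₁ ω₂ : ℝ}
    (hxy : Module.End.eigenspace (A : Phase →ₗ[ℂ] Phase) (I * ω₁) = xyPlane)
    (hz : Module.End.eigenspace (A : Phase →ₗ[ℂ] Phase) (I * ω₂) = zAxis) (w : Phase) (i : Fin 3) :
    A w i = I * (![ω₁, ω₁, ω₂] i : ℝ) * w i := by
  have hx : A ![1, 0, 0] = (I * (ω₁ : ℂ)) • ![1, 0, 0] := by
    have : (![1, 0, 0] : Phase) ∈ xyPlane := Submodule.subset_span (by simp)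
    rw [← hxy] at this
    exact Module.End.mem_eigenspace_iff.1 this
  have hy : A ![0, 1, 0] = (I * (ω₁ : ℂ)) • ![0, 1, 0] := by
    have : (![0, 1, 0] : Phase) ∈ xyPlane := Submodule.subset_span (by simp)
    rw [← hxy] at this
    exact Module.End.mem_eigenspace_iff.1 this
  have hz' : A ![0, 0, 1] = (I * (ω₂ : ℂ)) • ![0, 0, 1] := by
    have : (![0, 0, 1] : Phase) ∈ zAxis := Submodule.mem_span_singleton_self _
    rw [← hz] at this
    exact Module.End.mem_eigenspace_iff.1 this
  have hw : w = w 0 • ![1, 0, 0] + w 1 • ![0, 1, 0] + w 2 • ![0, 0, 1] := by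
    ext i
    fin_cases i <;> simp
  conv_lhs => rw [hw]
  simp only [map_add, map_smul, hx, hy, hz']
  fin_cases i <;> simp <;> ring

end CenterFamily

/-! ### The theorem. -/

open CenterFamily in
theorem theoremT
    (U : Set CenterFamily.Phase) (hU : IsOpen U) (h0U : (0 : CenterFamily.Phase) ∈ U)
    (X : CenterFamily.Phase → CenterFamily.Phase)
    (hX : DifferentiableOn ℂ X U) (hX0 : X 0 = 0)
    (ω₁ ω₂ : ℝ) (hω₁ : ω₁ ≠ 0) (hne : ω₁ ≠ ω₂) (hle : |ω₁| ≤ |ω₂|)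
    (hxy : Module.End.eigenspace (fderiv ℂ X 0 : CenterFamily.Phase →ₗ[ℂ] CenterFamily.Phase)
      (Complex.I * ω₁) = CenterFamily.xyPlane)
    (hz : Module.End.eigenspace (fderiv ℂ X 0 : CenterFamily.Phase →ₗ[ℂ] CenterFamily.Phase)
      (Complex.I * ω₂) = CenterFamily.zAxis) :
    CenterFamily.ExistsCenterFamily U X CenterFamily.zAxis (2 * Real.pi / |ω₂|) ∧
    ((¬ ∃ n : ℕ, ω₂ / ω₁ = n) →
      CenterFamily.InfinitelyManyCenterFamilies U X CenterFamily.xyPlane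
        (2 * Real.pi / |ω₁|)) ∧
    (∀ n : ℕ, ω₂ / ω₁ = n →
      (CenterFamily.rBar X n = 0 ∧ CenterFamily.rHat X n = 0 →
        CenterFamily.InfinitelyManyCenterFamilies U X CenterFamily.xyPlane
          (2 * Real.pi / |ω₁|)) ∧
      (CenterFamily.rBar X n = 0 ∧ CenterFamily.rHat X n ≠ 0 →
        CenterFamily.InfinitelyManyCenterFamilies U X CenterFamily.yAxis
          (2 * Real.pi / |ω₁|)) ∧
      (CenterFamily.rBar X n ≠ 0 ∧ CenterFamily.rHat X n = 0 →
        CenterFamily.InfinitelyManyCenterFamilies U X CenterFamily.xAxis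
          (2 * Real.pi / |ω₁|))) := by
  have hU0 : U ∈ 𝓝 (0 : Phase) := hU.mem_nhds h0U
  have hXd : ∀ᶠ w in 𝓝 0, DifferentiableAt ℂ X w := by
    filter_upwards [hU0] with w hw using hX.differentiableAt (hU.mem_nhds hw)
  have hA := apply_eq_of_eigenspaces hxy hz
  have h1pos : 0 < |ω₁| := abs_pos.2 hω₁
  have hω₂ : ω₂ ≠ 0 := abs_pos.1 (h1pos.trans_le hle)
  refine ⟨?_, fun hnot => ?_, fun n hn => ?_⟩
  · obtain ⟨ρ, φ, hφ, hder⟩ := exists_linearizedCurve_of_nonresonant hU0 hXd hX0 hω₂ hA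
      (c := ![0, 0, 1])
      -- For `k ≥ 2`, `|k ω₂| ≥ 2 |ω₂|` exceeds both `|ω₁|` and `|ω₂|`.
      (by
        intro k hk i heq
        have hk' : (2 : ℝ) ≤ k := by exact_mod_cast hk
        have h1 : |![ω₁, ω₁, ω₂] i| ≤ |ω₂| := by fin_cases i <;> simp [hle]
        rw [← heq, abs_mul, Nat.abs_cast] at h1
        nlinarith)
      (fun h => by simpa using congrFun h 2)
      (by intro i; fin_cases i <;> simp)
    exact hφ.existsCenterFamily hω₂ (hder ▸ Submodule.mem_span_singleton_self _)
  · have hcurve : ∀ j : ℕ, ∃ ρ φ, IsLinearizedCurve U X ω₁ φ ρ ∧ deriv φ 0 = ![(j : ℂ), 1, 0] := by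
      intro j
      refine exists_linearizedCurve_of_nonresonant hU0 hXd hX0 hω₁ hA ?_
        (fun h => by simpa using congrFun h 1) (by intro i; fin_cases i <;> simp)
      intro k hk i heq
      have hk' : (2 : ℝ) ≤ k := by exact_mod_cast hk
      have h1 : (k : ℝ) * ω₁ ≠ ω₁ := by
        intro h
        have := mul_right_cancel₀ hω₁ (h.trans (one_mul _).symm)
        linarith
      fin_cases i
      · exact h1 heq
      · exact h1 heq
      · exact hnot ⟨k, (div_eq_iff hω₁).2 heq.symm⟩
    choose ρ φ hφ hder using hcurve
    refine infinitelyManyCenterFamilies_of_curves hω₁ hφ (fun j => ?_) fun i j hij => ?_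
    · rw [hder, xyPlane, Submodule.mem_span_pair]
      exact ⟨j, 1, by ext i; fin_cases i <;> simp⟩
    · have hd : ∀ j, HasDerivAt (φ j) ![(j : ℂ), 1, 0] 0 := fun j =>
        hder j ▸ (hφ j).hasDerivAt (mem_ball_self (hφ j).pos)
      refine germNotLe_of_deriv_ne (hd i) (hd j) (hφ i).map_zero (hφ j).map_zero
        (ContinuousLinearMap.proj 1) rfl rfl fun h => hij ?_
      simpa using congrFun h 0
  · have hω : ω₂ = n * ω₁ := (div_eq_iff hω₁).1 hn
    -- Hence `n - 2` in `rBar` and `rHat` is a true difference.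
    have hn2 : 2 ≤ n := by
      by_contra hlt
      have h01 : n = 0 ∨ n = 1 := by omega
      rcases h01 with rfl | rfl
      · exact hω₂ (by simpa using hω)
      · exact hne (by simpa using hω.symm)
    have hA' : ∀ a b c, fderiv ℂ X 0 ![a, b, c] =
        ![I * ω₁ * a, I * ω₁ * b, I * (n * ω₁) * c] := by
      intro a b c
      ext i
      rw [hA]
      fin_cases i <;> simp [hω]
    -- The curves tangent to the `y`-axis serve both for the `(x,y)`-plane and for the `y`-axis
    -- itself.
    have hY : rBar X n = 0 → ∀ L : Submodule ℂ Phase, ![0, 1, 0] ∈ L →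
        InfinitelyManyCenterFamilies U X L (2 * Real.pi / |ω₁|) := by
      intro hr L hL
      obtain ⟨ρ, φ, hφ, hder, hne⟩ :=
        exists_linearizedCurves_of_rBar_eq_zero hU0 hω₁ hXd hX0 hn2 hA' hr
      exact infinitelyManyCenterFamilies_of_curves hω₁ hφ (fun j => by rwa [hder]) hne
    refine ⟨fun h => hY h.1 _ (Submodule.subset_span (by simp)),
      fun h => hY h.1 _ (Submodule.mem_span_singleton_self _), fun h => ?_⟩
    obtain ⟨ρ, φ, hφ, hder, hne⟩ :=
      exists_linearizedCurves_of_rHat_eq_zero hU0 hω₁ hXd hX0 hn2 hA' h.2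
    exact infinitelyManyCenterFamilies_of_curves hω₁ hφ
      (fun j => hder j ▸ Submodule.mem_span_singleton_self _) hne
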